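/- **Setting.** For $l=1,2$ let $X_l\subset\mathbb R^{m_l}$ be nonempty, compact and convex, let $\|\cdot\|$ be a norm on $\mathbb R^{m_l}$ with dual norm $\|\cdot\|_*$, and let $\mathcal V_l=\{1,\dots,n_l\}$, $n_l\ge 1$, be the agents of subnetwork $l$. Let $\xi$ be a random vector in $\mathbb R^d$ and let $f_{l,i}(x_1,x_2)=\mathbb E[\phi_{l,i}(x_1,x_2;\xi)]$ (the expectations being finite) be continuous on $X_1\times X_2$, convex in $x_l$ and concave in $x_{3-l}$, with $$U(x_1,x_2)=\frac1{n_1}\sum_{i=1}^{n_1}f_{1,i}(x_1,x_2)=-\frac1{n_2}\sum_{j=1}^{n_2}f_{2,j}(x_1,x_2).$$ A Nash equilibrium is a point $(x_1^*,x_2^*)\in X_1\times X_2$ with $U(x_1^*,x_2)\le U(x_1^*,x_2^*)\le U(x_1,x_2^*)$ for all $(x_1,x_2)\in X_1\times X_2$. *Communication.* For some $\eta\in(0,1)$, the mixing matrices $W_l(t)=[w_{l,ij}(t)]$, $t\ge0$, are doubly stochastic with $w_{l,ij}(t)\ge\eta$ if $(j,i)\in\mathcal E_l(t)$ and $w_{l,ij}(t)=0$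 otherwise, where the digraphs $(\mathcal V_l,\mathcal E_l(t))$ contain all self-loops and are uniformly jointly strongly connected: there is $B_l\ge1$ such that for every $k\ge0$ the union of the graphs at times $k,\dots,k+B_l-1$ is strongly connected. The weights $w_{12,ij}(t)\ge0$ that an agent $i\in\mathcal V_l$ gives to the agents $j\in\mathcal V_{3-l}$ sum to $1$ and are positive only along edges of a bipartite digraph $\mathcal G_{12}(t)$. *Regularizers.* Let $\psi_l$ be continuous and $1$-strongly convex on $X_l$ and differentiable (relative to $X_l$) at the points of a set $X_l^\circ\subseteq X_l$; put $D_{\psi_l}(x,p)=\psi_l(x)-\psi_l(p)-\langle\nabla\psi_l(p),x-p\rangle$ for $x\in X_l$, $p\in X_l^\circ$, and $P^l_x(y)=\arg\min_{x'\in X_l}\{\langle y,x-x'\rangle+D_{\psi_l}(x',x)\}$ for $x\in X_l^\circ$, and suppose $P^l_x(y)\in X_l^\circ$ for all $x\in X_l^\circ$ and all $y$. (If $\psi_l$ is differentiable on $X_l$, one can take $X_l^\circ=X_l$; for the entropy on the simplex, $X_l^\circ$ is its positive part.) *Algorithm (D-SMD).* Let $\alpha(t)\ge0$ be non-increasing.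 From (possibly random) $x_{l,i}(0)\in X_l^\circ$, $$v_{l,i}(t)=\sum_{j}w_{l,ij}(t)x_{l,j}(t),\qquad u_{3-l,i}(t)=\sum_j w_{12,ij}(t)x_{3-l,j}(t),\qquad x_{l,i}(t+1)=P^l_{v_{l,i}(t)}(-\alpha(t)\hat g_{l,i}(t)),$$ where the $\xi_{l,i}(t)$ are i.i.d. copies of $\xi$, and $\hat g_{l,i}(t)$ is a subgradient of $\phi_{l,i}$ in its $l$-th variable on $X_l$ at the point with $l$-th component $v_{l,i}(t)$ and other component $u_{3-l,i}(t)$, for the sample $\xi_{l,i}(t)$. Let $\mathcal F_t$ be generated by all $x_{l,i}(0)$ and all $\xi_{l,i}(s)$, $s\le t-1$; $\hat g_{l,i}(t)$ is $\mathcal F_{t+1}$-measurable. **Assumptions.** * (A1) There is $L>0$ with $|f_{l,i}(x_1,x_2)-f_{l,i}(x_1',x_2')|\le L(\|x_1-x_1'\|+\|x_2-x_2'\|)$ on $X_1\times X_2$ for all $l,i$. * (A2) There are $\nu_l>0$ and subgradients $g_{l,i}(t)$ of $f_{l,i}$ in its $l$-th variable on $X_l$, at the same points as $\hat g_{l,i}(t)$,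 with $\|g_{l,i}(t)\|_*\le L$ (automatic at interior points of $X_l$), such that $\hat g_{l,i}(t)$ and $\|g_{l,i}(t)-\hat g_{l,i}(t)\|_*^2$ are integrable, $\mathbb E[\hat g_{l,i}(t)\mid\mathcal F_t]=g_{l,i}(t)$ and $\mathbb E[\|g_{l,i}(t)-\hat g_{l,i}(t)\|_*^2\mid\mathcal F_t]\le\nu_l^2$ almost surely. * (A3) For every $x\in X_l$, $D_{\psi_l}(x,\cdot)$ is convex on $X_l^\circ$ (in particular $X_l^\circ$ is convex), and $D_{\psi_l}(x,p_k)\to0$ whenever $p_k\in X_l^\circ$ and $p_k\to x$. **Theorem.** Let $U$ be strictly convex in $x_1\in X_1$ and strictly concave in $x_2\in X_2$, let (A1)-(A3) hold, and let $\sum_{t=1}^\infty\alpha(t)=\infty$ and $\sum_{t=1}^\infty\alpha^2(t)<\infty$. Then the game has a unique Nash equilibrium $(x_1^*,x_2^*)$, and with probability $1$ $$\lim_{t\to\infty}x_{1,i}(t)=x_1^*,\qquad\lim_{t\to\infty}x_{2,j}(t)=x_2^*\qquad\text{for all }i\in\mathcal V_1,\ j\in\mathcal V_2.$$ -/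

import Mathlib

open MeasureTheory ProbabilityTheory Filter Topology

noncomputable section

namespace DSMD

section Prox

variable {V : Type*} [NormedAddCommGroup V] [NormedSpace ℝ V]

/-- `g` is a subgradient at `x` of the function `h` considered on the set `S`. -/
def IsSubgradient (S : Set V) (h : V → ℝ) (x : V) (g : StrongDual ℝ V) : Prop :=
  ∀ y ∈ S, h x + g (y - x) ≤ h y

/-- The Bregman divergence `D_ψ(x, p) = ψ(x) - ψ(p) - ⟨∇ψ(p), x - p⟩` of a function on `X`.
For convex `X`, `x, p ∈ X`, and `ψ` differentiable at `p` relative to `X`, the last term is the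
directional derivative of `ψ` at `p` towards `x`, whatever representative of the derivative
relative to `X` is taken. -/
def bregman (X : Set V) (ψ : V → ℝ) (x p : V) : ℝ :=
  ψ x - ψ p - fderivWithin ℝ ψ X p (x - p)

/-- `p = P_x(y)`, i.e. `p` minimizes `⟨y, x - x'⟩ + D_ψ(x', x)` over `x' ∈ X`. -/
def IsProx (X : Set V) (ψ : V → ℝ) (x : V) (y : StrongDual ℝ V) (p : V) : Prop :=
  p ∈ X ∧ IsMinOn (fun x' => y (x - x') + bregman X ψ x' x) X p

/-- A `1`-strongly convex regularizer on `X`, differentiable on the set `dom`. If `ψ` is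
differentiable on all of `X`, one takes `dom = X` and then `dom_subset`, `prox_mem` and
`continuousOn` are automatic. A smaller `dom` allows for regularizers such as the entropy on the
simplex, with `dom` the positive part of the simplex. -/
structure Regularizer (X : Set V) where
  ψ : V → ℝ
  dom : Set V
  dom_subset : dom ⊆ X
  continuousOn : ContinuousOn ψ X
  strongConvexOn : StrongConvexOn X 1 ψ
  differentiable : ∀ p ∈ dom, DifferentiableWithinAt ℝ ψ X p
  prox_mem : ∀ x ∈ dom, ∀ y p, IsProx X ψ x y p → p ∈ dom

/-- The divergence is convex in its second argument, and Bregman reciprocity holds. -/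
structure Regularizer.Reciprocal {X : Set V} (R : Regularizer X) : Prop where
  convex_right : ∀ x ∈ X, ConvexOn ℝ R.dom (fun p => bregman X R.ψ x p)
  reciprocity : ∀ x ∈ X, ∀ p : ℕ → V, (∀ k, p k ∈ R.dom) → Tendsto p atTop (𝓝 x) →
    Tendsto (fun k => bregman X R.ψ x (p k)) atTop (𝓝 0)

end Prox

/-- Communication structure of the two subnetworks (indexed by `l : Fin 2`, with `n l` agents).
`W l l t` is the mixing matrix inside subnetwork `l`; for `k ≠ l`, `W l k t` holds the weights
that the agents of subnetwork `l` give to the agents of subnetwork `k`. `Adj j i` is the edge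
from `j` to `i`. -/
structure Network (n : Fin 2 → ℕ) where
  G : ∀ l, ℕ → Digraph (Fin (n l))
  G₁₂ : ℕ → Digraph (Σ l, Fin (n l))
  W : ∀ l k, ℕ → Matrix (Fin (n l)) (Fin (n k)) ℝ
  η : ℝ
  η_pos : 0 < η
  η_lt_one : η < 1
  self_loop : ∀ l t i, (G l t).Adj i i
  jointly_connected : ∀ l, ∃ B : ℕ, 1 ≤ B ∧ ∀ s : ℕ, ∀ i j : Fin (n l),
    Relation.ReflTransGen (fun a b => ∃ t, s ≤ t ∧ t < s + B ∧ (G l t).Adj a b) i j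
  bipartite : ∀ t a b, (G₁₂ t).Adj a b → a.1 ≠ b.1
  weight_ge : ∀ l t i j, (G l t).Adj j i → η ≤ W l l t i j
  weight_zero : ∀ l t i j, ¬ (G l t).Adj j i → W l l t i j = 0
  col_sum : ∀ l t j, ∑ i, W l l t i j = 1
  row_sum : ∀ l k t i, ∑ j, W l k t i j = 1
  cross_nonneg : ∀ l k t i j, k ≠ l → 0 ≤ W l k t i j
  cross_edge : ∀ l k t i j, k ≠ l → 0 < W l k t i j → (G₁₂ t).Adj ⟨k, j⟩ ⟨l, i⟩

section Game

variable {Ω : Type*} [MeasurableSpace Ω]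
  {E : Fin 2 → Type*} [∀ l, NormedAddCommGroup (E l)] [∀ l, NormedSpace ℝ (E l)]

/-- The expected cost `f(x) = 𝔼[φ(x; ξ)]` of a sampled cost `φ` at the profile `x`. -/
def expectedCost (P : Measure Ω) {d : ℕ} (ξ : Ω → Fin d → ℝ)
    (φ : (∀ k, E k) → (Fin d → ℝ) → ℝ) (x : ∀ k, E k) : ℝ :=
  ∫ ω, φ x (ξ ω) ∂P

variable (E) in
/-- A two-network stochastic zero-sum game. Player `0` is the minimizing and player `1` the
maximizing subnetwork; `φ l i` is the sampled cost of agent `i` of subnetwork `l`. -/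
structure Game (P : Measure Ω) (n : Fin 2 → ℕ) (d : ℕ) where
  X : ∀ l, Set (E l)
  ξ : Ω → Fin d → ℝ
  φ : ∀ l, Fin (n l) → (∀ k, E k) → (Fin d → ℝ) → ℝ
  agents_pos : ∀ l, 0 < n l
  nonempty : ∀ l, (X l).Nonempty
  compact : ∀ l, IsCompact (X l)
  convex : ∀ l, Convex ℝ (X l)
  measurable_ξ : Measurable ξ
  integrable : ∀ l i, ∀ x ∈ Set.univ.pi X, Integrable (fun ω => φ l i x (ξ ω)) P
  cost_continuous : ∀ l i, ContinuousOn (expectedCost P ξ (φ l i)) (Set.univ.pi X)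
  cost_convex : ∀ l i, ∀ x ∈ Set.univ.pi X,
    ConvexOn ℝ (X l) (fun y => expectedCost P ξ (φ l i) (Function.update x l y))
  cost_concave : ∀ l i, ∀ k ≠ l, ∀ x ∈ Set.univ.pi X,
    ConcaveOn ℝ (X k) (fun y => expectedCost P ξ (φ l i) (Function.update x k y))
  zero_sum : ∀ x ∈ Set.univ.pi X,
    (1 / (n 0 : ℝ)) * ∑ i, expectedCost P ξ (φ 0 i) x =
      -((1 / (n 1 : ℝ)) * ∑ j, expectedCost P ξ (φ 1 j) x)

namespace Game

variable {P : Measure Ω} {n : Fin 2 → ℕ} {d : ℕ}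

/-- The expected cost `f_{l,i}` of agent `i` of subnetwork `l`. -/
def f (Γ : Game E P n d) (l : Fin 2) (i : Fin (n l)) (x : ∀ k, E k) : ℝ :=
  expectedCost P Γ.ξ (Γ.φ l i) x

/-- The cost function of the game. -/
def U (Γ : Game E P n d) (x : ∀ k, E k) : ℝ :=
  (1 / (n 0 : ℝ)) * ∑ i, Γ.f 0 i x

/-- `U` is strictly convex in the first and strictly concave in the second variable. -/
def StrictConvexConcave (Γ : Game E P n d) : Prop :=
  ∀ x ∈ Set.univ.pi Γ.X,
    StrictConvexOn ℝ (Γ.X 0) (fun y => Γ.U (Function.update x 0 y)) ∧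
    StrictConcaveOn ℝ (Γ.X 1) (fun y => Γ.U (Function.update x 1 y))

/-- Nash equilibrium: `U(x₁*, x₂) ≤ U(x₁*, x₂*) ≤ U(x₁, x₂*)` for all `(x₁, x₂) ∈ X₁ × X₂`. -/
def IsNash (Γ : Game E P n d) (x : ∀ k, E k) : Prop :=
  x ∈ Set.univ.pi Γ.X ∧
    (∀ y ∈ Γ.X 1, Γ.U (Function.update x 1 y) ≤ Γ.U x) ∧
    (∀ y ∈ Γ.X 0, Γ.U x ≤ Γ.U (Function.update x 0 y))

/-- Every expected cost is Lipschitz continuous over `X₁ × X₂` with constant `L`. -/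
def LipschitzCosts (Γ : Game E P n d) (L : ℝ) : Prop :=
  ∀ l i, ∀ x ∈ Set.univ.pi Γ.X, ∀ x' ∈ Set.univ.pi Γ.X,
    |Γ.f l i x - Γ.f l i x'| ≤ L * (‖x 0 - x' 0‖ + ‖x 1 - x' 1‖)

end Game

/-- The weighted averages computed by agent `i` of subnetwork `l` at time `t` from the strategies
`x`: the `l`-th component is `v_{l,i}(t)`, the other one is the average `u_{3-l,i}(t)` of the
strategies in the other subnetwork. -/
def estimate {n : Fin 2 → ℕ} (N : Network n) (t : ℕ) (x : ∀ k, Fin (n k) → E k)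
    (l : Fin 2) (i : Fin (n l)) : ∀ k, E k :=
  fun k => ∑ j, N.W l k t i j • x k j

variable {P : Measure Ω} {n : Fin 2 → ℕ} {d : ℕ}

/-- A run of distributed stochastic mirror descent with step sizes `α`: samples `sample`,
strategies `x` and sampled subgradients `ghat`. `info t` is the `σ`-algebra generated by the
initial strategies and the samples up to time `t - 1`; the sampled subgradients at time `t` are
determined by the information up to time `t`. -/
structure Run [∀ l, MeasurableSpace (E l)] (Γ : Game E P n d) (N : Network n)
    (R : ∀ l, Regularizer (Γ.X l)) (α : ℕ → ℝ) where
  sample : ∀ l, Fin (n l) → ℕ → Ω → Fin d → ℝ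
  x : ∀ l, Fin (n l) → ℕ → Ω → E l
  ghat : ∀ l, Fin (n l) → ℕ → Ω → StrongDual ℝ (E l)
  info : ℕ → MeasurableSpace Ω
  info_eq : ∀ t, info t =
    (⨆ l, ⨆ i, MeasurableSpace.comap (x l i 0) inferInstance) ⊔
      ⨆ s, ⨆ (_ : s < t), ⨆ l, ⨆ i, MeasurableSpace.comap (sample l i s) inferInstance
  sample_measurable : ∀ l i t, Measurable (sample l i t)
  sample_indep : iIndepFun (fun a : (Σ l, Fin (n l)) × ℕ => sample a.1.1 a.1.2 a.2) P
  sample_ident : ∀ l i t, IdentDistrib (sample l i t) Γ.ξ P P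
  init_measurable : ∀ l i, Measurable (x l i 0)
  init_mem : ∀ l i ω, x l i 0 ω ∈ (R l).dom
  ghat_measurable : ∀ l i t, StronglyMeasurable[info (t + 1)] (ghat l i t)
  ghat_subgradient : ∀ l i t ω,
    IsSubgradient (Γ.X l)
      (fun y => Γ.φ l i
        (Function.update (estimate N t (fun k j => x k j t ω) l i) l y) (sample l i t ω))
      (estimate N t (fun k j => x k j t ω) l i l) (ghat l i t ω)
  step : ∀ l i t ω,
    IsProx (Γ.X l) (R l).ψ (estimate N t (fun k j => x k j t ω) l i l)
      (-(α t • ghat l i t ω)) (x l i (t + 1) ω)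

variable [∀ l, MeasurableSpace (E l)] {Γ : Game E P n d} {N : Network n}
  {R : ∀ l, Regularizer (Γ.X l)} {α : ℕ → ℝ}

/-- `g l i t` is a subgradient of `f_{l,i}` in the `l`-th variable at the point at which agent `i`
samples at time `t`, with dual norm at most `L`. If `f_{l,i}` is `L`-Lipschitz, the norm bound
selects exactly the subgradients of the `L`-Lipschitz extension `inf_z (f(z) + L ‖· - z‖)`
to the whole space; it is automatic at interior points of `X_l`, while at boundary points it
excludes the addition of arbitrarily large normal vectors. -/
def Run.IsCostSubgradient (r : Run Γ N R α) (L : ℝ)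
    (g : ∀ l, Fin (n l) → ℕ → Ω → StrongDual ℝ (E l)) : Prop :=
  ∀ l i t ω,
    IsSubgradient (Γ.X l)
      (fun y => Γ.f l i (Function.update (estimate N t (fun k j => r.x k j t ω) l i) l y))
      (estimate N t (fun k j => r.x k j t ω) l i l) (g l i t ω) ∧
    ‖g l i t ω‖ ≤ L

/-- The sampled subgradients are conditionally unbiased with conditional variance at most
`ν l ^ 2`. -/
structure Run.UnbiasedBounded (r : Run Γ N R α) (ν : Fin 2 → ℝ)
    (g : ∀ l, Fin (n l) → ℕ → Ω → StrongDual ℝ (E l)) : Prop where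
  integrable : ∀ l i t, Integrable (r.ghat l i t) P
  integrable_sq : ∀ l i t, Integrable (fun ω => ‖g l i t ω - r.ghat l i t ω‖ ^ 2) P
  unbiased : ∀ l i t, P[r.ghat l i t | r.info t] =ᵐ[P] g l i t
  variance : ∀ l i t,
    P[fun ω => ‖g l i t ω - r.ghat l i t ω‖ ^ 2 | r.info t] ≤ᵐ[P] fun _ => ν l ^ 2

end Game

end DSMD

end

/-!
Mirror descent is a stochastic quasi-Fejér iteration: averaged over each subnetwork and summed over
the two, the Bregman divergence from the iterates to a Nash equilibrium decreases in each step by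
`α t` times the gap of the profile of mean strategies. Since the game is zero-sum, the costs of the
two subnetworks combine to this gap. The remaining terms are the consensus errors, which are square
summable because the mixing matrices contract diameters geometrically, the variance terms, and
martingale noise. By Robbins–Siegmund the divergence converges almost surely and the weighted gaps
are summable, so the gap tends to zero along a subsequence; strict convexity and concavity identify
the limit of that subsequence as the equilibrium. Bregman reciprocity makes the divergence small
along it, hence the limit of the divergence is zero.
-/

namespace DSMD

section Bregman

variable {V : Type*} [NormedAddCommGroup V] [NormedSpace ℝ V] {X : Set V} {ψ : V → ℝ} {m : ℝ}
  {x p v : V} {y : StrongDual ℝ V}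

lemma tendsto_slope_fderivWithin (hX : Convex ℝ X) (hx : x ∈ X) (hp : p ∈ X)
    (hd : DifferentiableWithinAt ℝ ψ X p) :
    Tendsto (fun s : ℝ => s⁻¹ * (ψ (p + s • (x - p)) - ψ p)) (𝓝[>] 0)
      (𝓝 (fderivWithin ℝ ψ X p (x - p))) := by
  refine hd.hasFDerivWithinAt.lim (c := fun s : ℝ => s⁻¹) (d := fun s : ℝ => s • (x - p)) ?_ ?_ ?_
  · have h : Tendsto (fun s : ℝ => s • (x - p)) (𝓝 0) (𝓝 ((0 : ℝ) • (x - p))) :=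
      tendsto_id.smul_const _
    simpa using h.mono_left nhdsWithin_le_nhds
  · filter_upwards [Ioc_mem_nhdsGT zero_lt_one] with s hs
    exact hX.add_smul_sub_mem hp hx ⟨hs.1.le, hs.2⟩
  · refine tendsto_const_nhds.congr' ?_
    filter_upwards [self_mem_nhdsWithin] with s hs
    rw [inv_smul_smul₀ (ne_of_gt hs)]

lemma bregman_self : bregman X ψ x x = 0 := by simp [bregman]

lemma mul_norm_sq_le_bregman (hψ : StrongConvexOn X m ψ) (hx : x ∈ X) (hp : p ∈ X)
    (hd : DifferentiableWithinAt ℝ ψ X p) : m / 2 * ‖x - p‖ ^ 2 ≤ bregman X ψ x p := by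
  set q := m / 2 * ‖x - p‖ ^ 2 with hq
  have hlim : Tendsto (fun s : ℝ => ψ x - ψ p - (1 - s) * q) (𝓝[>] 0)
      (𝓝 (ψ x - ψ p - (1 - 0) * q)) :=
    (Continuous.tendsto (by fun_prop) 0).mono_left nhdsWithin_le_nhds
  have hle : fderivWithin ℝ ψ X p (x - p) ≤ ψ x - ψ p - (1 - 0) * q := by
    refine le_of_tendsto_of_tendsto (tendsto_slope_fderivWithin hψ.1 hx hp hd) hlim ?_
    filter_upwards [Ioc_mem_nhdsGT zero_lt_one] with s hs
    have hseg : s • x + (1 - s) • p = p + s • (x - p) := by module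
    have hconv := hψ.2 hx hp hs.1.le (sub_nonneg.2 hs.2) (by ring)
    rw [hseg] at hconv
    rw [inv_mul_le_iff₀ hs.1, hq]
    simp only [smul_eq_mul] at hconv
    linarith
  unfold bregman
  linarith

lemma IsProx.bregman_add_bregman_le (hX : Convex ℝ X) (hp : IsProx X ψ v y p) (hx : x ∈ X)
    (hd : DifferentiableWithinAt ℝ ψ X p) :
    bregman X ψ x p + bregman X ψ p v ≤ bregman X ψ x v - y (x - p) := by
  have hvar : y (x - p) + fderivWithin ℝ ψ X v (x - p) ≤ fderivWithin ℝ ψ X p (x - p) := by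
    refine ge_of_tendsto (tendsto_slope_fderivWithin hX hx hp.1 hd) ?_
    filter_upwards [Ioc_mem_nhdsGT zero_lt_one] with s hs
    have hmin := isMinOn_iff.1 hp.2 _ (hX.add_smul_sub_mem hp.1 hx ⟨hs.1.le, hs.2⟩)
    have hy : v - (p + s • (x - p)) = (v - p) - s • (x - p) := by abel
    have hψ : p + s • (x - p) - v = (p - v) + s • (x - p) := by abel
    simp only [bregman, hy, hψ, map_sub y (v - p), map_add, map_smul, smul_eq_mul] at hmin
    rw [le_inv_mul_iff₀ hs.1]
    linarith
  have hsplit : fderivWithin ℝ ψ X v (x - v) =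
      fderivWithin ℝ ψ X v (x - p) + fderivWithin ℝ ψ X v (p - v) := by
    rw [← map_add, sub_add_sub_cancel]
  unfold bregman
  linarith

lemma IsProx.bregman_le (hm : 0 < m) (hψ : StrongConvexOn X m ψ) (hp : IsProx X ψ v y p)
    (hv : v ∈ X) (hx : x ∈ X) (hdp : DifferentiableWithinAt ℝ ψ X p)
    (hdv : DifferentiableWithinAt ℝ ψ X v) :
    bregman X ψ x p ≤ bregman X ψ x v - y (x - v) + ‖y‖ ^ 2 / (2 * m) := by
  have hpv := mul_norm_sq_le_bregman hψ hp.1 hv hdv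
  have hthree := hp.bregman_add_bregman_le hψ.1 hx hdp
  have hy : y (p - v) ≤ ‖y‖ * ‖p - v‖ := (le_abs_self _).trans (y.le_opNorm _)
  have hsplit : y (x - v) = y (x - p) + y (p - v) := by rw [← map_add, sub_add_sub_cancel]
  have hyoung : ‖y‖ * ‖p - v‖ ≤ ‖y‖ ^ 2 / (2 * m) + m / 2 * ‖p - v‖ ^ 2 := by
    have : ‖y‖ ^ 2 / (2 * m) + m / 2 * ‖p - v‖ ^ 2 - ‖y‖ * ‖p - v‖ =
        (‖y‖ - m * ‖p - v‖) ^ 2 / (2 * m) := by field_simp; ring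
    linarith [show 0 ≤ (‖y‖ - m * ‖p - v‖) ^ 2 / (2 * m) by positivity]
  linarith

lemma IsProx.mul_norm_sub_le (hψ : StrongConvexOn X m ψ) (hp : IsProx X ψ v y p) (hv : v ∈ X)
    (hdp : DifferentiableWithinAt ℝ ψ X p) (hdv : DifferentiableWithinAt ℝ ψ X v) :
    m * ‖p - v‖ ≤ ‖y‖ := by
  have hthree := hp.bregman_add_bregman_le hψ.1 hv hdp
  have hpv := mul_norm_sq_le_bregman hψ hp.1 hv hdv
  have hvp := mul_norm_sq_le_bregman hψ hv hp.1 hdp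
  have hy : y (p - v) ≤ ‖y‖ * ‖p - v‖ := (le_abs_self _).trans (y.le_opNorm _)
  rw [bregman_self, ← neg_sub p v, map_neg] at hthree
  rw [norm_sub_rev] at hvp
  rcases (norm_nonneg (p - v)).eq_or_lt with h0 | h0
  · simp [← h0]
  · exact le_of_mul_le_mul_right (by linarith) h0

lemma IsProx.unique (hψ : StrictConvexOn ℝ X ψ) {p q : V} (hp : IsProx X ψ v y p)
    (hq : IsProx X ψ v y q) : p = q := by
  have hobj : StrictConvexOn ℝ X fun z => y (v - z) + bregman X ψ z v := by
    refine ((hψ.add_convexOn ((-(y + fderivWithin ℝ ψ X v)).toLinearMap.convexOn hψ.1)).add_const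
      (y v - ψ v + fderivWithin ℝ ψ X v v)).congr fun z _ => ?_
    simp [bregman]
    ring
  exact hobj.eq_of_isMinOn hp.2 hq.2 hp.1 hq.1

end Bregman

section Consensus

variable {ι V : Type*} [Fintype ι] [NormedAddCommGroup V] [NormedSpace ℝ V]

lemma dist_sum_smul_le_diam (x : ι → V) {p q : ι → ℝ} (hp : ∀ j, 0 ≤ p j) (hq : ∀ j, 0 ≤ q j)
    (hp1 : ∑ j, p j = 1) (hq1 : ∑ j, q j = 1) :
    dist (∑ j, p j • x j) (∑ j, q j • x j) ≤ Metric.diam (Set.range x) := by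
  have hmem : ∀ w : ι → ℝ, (∀ j, 0 ≤ w j) → ∑ j, w j = 1 →
      ∑ j, w j • x j ∈ convexHull ℝ (Set.range x) := fun w hw hw1 =>
    (convex_convexHull ℝ _).sum_mem (fun j _ => hw j) hw1
      fun j _ => subset_convexHull ℝ _ (Set.mem_range_self j)
  rw [← convexHull_diam]
  exact Metric.dist_le_diam_of_mem
    (isBounded_convexHull.2 (Set.finite_range x).isBounded) (hmem p hp hp1) (hmem q hq hq1)

lemma dist_sum_smul_le_mul_diam (x : ι → V) {p q : ι → ℝ} {ε : ℝ} (hp : ∀ j, ε ≤ p j)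
    (hq : ∀ j, ε ≤ q j) (hp1 : ∑ j, p j = 1) (hq1 : ∑ j, q j = 1) :
    dist (∑ j, p j • x j) (∑ j, q j • x j) ≤
      (1 - Fintype.card ι * ε) * Metric.diam (Set.range x) := by
  set c : ℝ := 1 - Fintype.card ι * ε with hc
  have hsum : ∀ w : ι → ℝ, ∑ j, w j = 1 → ∑ j, (w j - ε) = c := fun w hw => by simp [hw, hc]
  have hc0 : 0 ≤ c := hsum p hp1 ▸ Finset.sum_nonneg fun j _ => sub_nonneg.2 (hp j)
  rcases hc0.eq_or_lt with h0 | h0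
  · have heq : ∀ w : ι → ℝ, (∀ j, ε ≤ w j) → ∑ j, w j = 1 → w = fun _ => ε := fun w hw hw1 =>
      funext fun j => sub_eq_zero.1 ((Finset.sum_eq_zero_iff_of_nonneg
        fun j _ => sub_nonneg.2 (hw j)).1 ((hsum w hw1).trans h0.symm) j (Finset.mem_univ j))
    simp [heq p hp hp1, heq q hq hq1, ← h0]
  · have hscale : ∀ w : ι → ℝ,
        ∑ j, w j • x j = c • ∑ j, ((w j - ε) / c) • x j + ∑ j, ε • x j := fun w => by
      simp_rw [Finset.smul_sum, smul_smul, mul_div_cancel₀ _ h0.ne', sub_smul,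
        Finset.sum_sub_distrib, sub_add_cancel]
    rw [hscale p, hscale q, dist_add_right, dist_smul₀, Real.norm_of_nonneg hc0]
    gcongr
    refine dist_sum_smul_le_diam x (fun j => div_nonneg (sub_nonneg.2 (hp j)) hc0)
      (fun j => div_nonneg (sub_nonneg.2 (hq j)) hc0) ?_ ?_
    · rw [← Finset.sum_div, hsum p hp1, div_self h0.ne']
    · rw [← Finset.sum_div, hsum q hq1, div_self h0.ne']

lemma exists_rel_of_reflTransGen {β : Type*} {r : β → β → Prop} {S : Set β} {x y : β}
    (h : Relation.ReflTransGen r x y) (hx : x ∈ S) (hy : y ∉ S) :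
    ∃ a ∈ S, ∃ b ∉ S, r a b := by
  induction h with
  | refl => exact absurd hx hy
  | @tail b c _ hbc ih =>
    by_cases hb : b ∈ S
    · exact ⟨b, hb, c, hy, hbc⟩
    · exact ih hb

lemma eq_univ_of_forall_ssubset {R : ℕ → Finset ι} (hR0 : (R 0).Nonempty) (hmono : Monotone R)
    (hR : ∀ k, R k ≠ Finset.univ → R k ⊂ R (k + 1)) : R (Fintype.card ι) = Finset.univ := by
  have hcard : ∀ k, k < (R k).card ∨ R k = Finset.univ := by
    intro k
    induction k with
    | zero => exact Or.inl hR0.card_pos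
    | succ k ih =>
      by_cases huniv : R k = Finset.univ
      · exact Or.inr (Finset.univ_subset_iff.1 (huniv ▸ hmono k.le_succ))
      · exact Or.inl (Nat.lt_of_le_of_lt (ih.resolve_right huniv)
          (Finset.card_lt_card (hR k huniv)))
  exact (hcard _).resolve_left (Finset.card_le_univ _).not_gt

/-- A sequence of mixing matrices whose self-weights are at least `η` and for which the digraph of
all weights that are at least `η` at some of `B` consecutive times is strongly connected. The
weight `W t i j` belongs to the edge from `j` to `i`. -/
structure IsUniformlyMixing [DecidableEq ι] (W : ℕ → Matrix ι ι ℝ) (η : ℝ) (B : ℕ) : Prop where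
  mem_rowStochastic : ∀ t, W t ∈ Matrix.rowStochastic ℝ ι
  le_self : ∀ t i, η ≤ W t i i
  connected : ∀ s i j,
    Relation.ReflTransGen (fun a b => ∃ t, s ≤ t ∧ t < s + B ∧ η ≤ W t b a) i j

variable [DecidableEq ι] {W : ℕ → Matrix ι ι ℝ}

/-- The transition matrix `W (s + k - 1) ⋯ W s` of the averaging process from time `s` to time
`s + k`. -/
def transition (W : ℕ → Matrix ι ι ℝ) (s : ℕ) : ℕ → Matrix ι ι ℝ
  | 0 => 1
  | k + 1 => W (s + k) * transition W s k

lemma transition_mem_rowStochastic (hW : ∀ t, W t ∈ Matrix.rowStochastic ℝ ι) (s k : ℕ) :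
    transition W s k ∈ Matrix.rowStochastic ℝ ι := by
  induction k with
  | zero => exact one_mem _
  | succ k ih => exact mul_mem (hW _) ih

lemma mul_le_transition_succ (hW : ∀ t, W t ∈ Matrix.rowStochastic ℝ ι) (s k : ℕ) (i a b : ι) :
    W (s + k) b a * transition W s k a i ≤ transition W s (k + 1) b i :=
  Finset.single_le_sum (f := fun j => W (s + k) b j * transition W s k j i)
    (fun _ _ => mul_nonneg (Matrix.nonneg_of_mem_rowStochastic (hW _))
      (Matrix.nonneg_of_mem_rowStochastic (transition_mem_rowStochastic hW s k)))
    (Finset.mem_univ a)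

lemma IsUniformlyMixing.pow_le_transition {η : ℝ} {B : ℕ} (hW : IsUniformlyMixing W η B)
    (hη : 0 ≤ η) (s : ℕ) (i j : ι) :
    η ^ (B * Fintype.card ι) ≤ transition W s (B * Fintype.card ι) i j := by
  set R : ℕ → Finset ι := fun k => {a | η ^ k ≤ transition W s k a j} with hR
  have hmem : ∀ {k a}, a ∈ R k ↔ η ^ k ≤ transition W s k a j := by simp [hR]
  have hedge : ∀ {k a b}, η ≤ W (s + k) b a → a ∈ R k → b ∈ R (k + 1) := fun hab ha =>
    hmem.2 <| pow_succ' η _ ▸ (mul_le_mul hab (hmem.1 ha) (by positivity) (hη.trans hab)).trans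
      (mul_le_transition_succ hW.mem_rowStochastic s _ j _ _)
  have hmono : Monotone R := monotone_nat_of_le_succ fun k a => hedge (hW.le_self _ a)
  have hj : ∀ k, j ∈ R k := fun k => hmono k.zero_le (hmem.2 (by simp [transition]))
  refine hmem.1 (eq_univ_of_forall_ssubset (R := fun k => R (B * k)) ⟨j, hj _⟩
    (hmono.comp fun _ _ h => Nat.mul_le_mul_left B h) (fun k hk => ?_) ▸ Finset.mem_univ i)
  obtain ⟨c, hc⟩ : ∃ c, c ∉ R (B * k) := by
    simpa [Finset.eq_univ_iff_forall] using hk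
  obtain ⟨a, ha, b, hb, t, hst, hts, hab⟩ :=
    exists_rel_of_reflTransGen (S := R (B * k)) (hW.connected (s + B * k) j c) (hj _) hc
  obtain ⟨m, rfl⟩ := Nat.exists_eq_add_of_le hst
  rw [add_assoc] at hab
  have hbR : b ∈ R (B * (k + 1)) :=
    hmono (by rw [mul_add_one]; omega) (hedge hab (hmono (Nat.le_add_right _ _) ha))
  exact Finset.ssubset_iff_of_subset (hmono (Nat.mul_le_mul_left B k.le_succ)) |>.2 ⟨b, hbR, hb⟩

lemma norm_sub_transition_le (hW : ∀ t, W t ∈ Matrix.rowStochastic ℝ ι) {x e : ℕ → ι → V}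
    (hx : ∀ t i, x (t + 1) i = ∑ j, W t i j • x t j + e t i) (s k : ℕ) (i : ι) :
    ‖x (s + k) i - ∑ j, transition W s k i j • x s j‖ ≤
      ∑ τ ∈ Finset.range k, ∑ i, ‖e (s + τ) i‖ := by
  induction k generalizing i with
  | zero => simp [transition, Matrix.one_apply]
  | succ k ih =>
    have hrec : x (s + (k + 1)) i - ∑ j, transition W s (k + 1) i j • x s j =
        ∑ m, W (s + k) i m • (x (s + k) m - ∑ j, transition W s k m j • x s j) + e (s + k) i := by
      rw [← add_assoc, hx]
      simp_rw [transition, Matrix.mul_apply, smul_sub, Finset.sum_sub_distrib, Finset.smul_sum,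
        Finset.sum_smul, smul_smul]
      rw [Finset.sum_comm (γ := ι)]
      abel
    rw [hrec, Finset.sum_range_succ]
    refine (norm_add_le _ _).trans (add_le_add ?_ ?_)
    · calc ‖∑ m, W (s + k) i m • (x (s + k) m - ∑ j, transition W s k m j • x s j)‖
          ≤ ∑ m, W (s + k) i m * ∑ τ ∈ Finset.range k, ∑ i, ‖e (s + τ) i‖ := by
            refine norm_sum_le_of_le _ fun m _ => ?_
            have hnonneg : 0 ≤ W (s + k) i m := Matrix.nonneg_of_mem_rowStochastic (hW _)
            rw [norm_smul, Real.norm_of_nonneg hnonneg]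
            exact mul_le_mul_of_nonneg_left (ih m) hnonneg
        _ = ∑ τ ∈ Finset.range k, ∑ i, ‖e (s + τ) i‖ := by
            rw [← Finset.sum_mul, Matrix.sum_row_of_mem_rowStochastic (hW _), one_mul]
    · exact Finset.single_le_sum (f := fun i => ‖e (s + k) i‖) (fun _ _ => norm_nonneg _)
        (Finset.mem_univ i)

lemma diam_range_le_of_le_transition [Nonempty ι] (hW : ∀ t, W t ∈ Matrix.rowStochastic ℝ ι)
    {x e : ℕ → ι → V} (hx : ∀ t i, x (t + 1) i = ∑ j, W t i j • x t j + e t i) {s k : ℕ} {ε : ℝ}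
    (hε : ∀ i j, ε ≤ transition W s k i j) :
    Metric.diam (Set.range (x (s + k))) ≤
      (1 - Fintype.card ι * ε) * Metric.diam (Set.range (x s)) +
        2 * ∑ τ ∈ Finset.range k, ∑ i, ‖e (s + τ) i‖ := by
  refine Metric.diam_le_of_forall_dist_le_of_nonempty (Set.range_nonempty _) ?_
  rintro _ ⟨i, rfl⟩ _ ⟨j, rfl⟩
  have hΦ := Matrix.sum_row_of_mem_rowStochastic (transition_mem_rowStochastic hW s k)
  have hi := norm_sub_transition_le hW hx s k i
  have hj := norm_sub_transition_le hW hx s k j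
  have hij := dist_sum_smul_le_mul_diam (x s) (hε i) (hε j) (hΦ i) (hΦ j)
  rw [← dist_eq_norm] at hi hj
  rw [dist_comm] at hj
  linarith [dist_triangle4 (x (s + k) i) (∑ l, transition W s k i l • x s l)
    (∑ l, transition W s k j l • x s l) (x (s + k) j)]

lemma summable_of_delayed_contraction {a b : ℕ → ℝ} {ρ : ℝ} {k : ℕ} (ha : ∀ t, 0 ≤ a t)
    (hb : ∀ t, 0 ≤ b t) (hρ : ρ < 1) (hbs : Summable b) (h : ∀ t, a (t + k) ≤ ρ * a t + b t) :
    Summable a := by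
  refine summable_of_sum_range_le (c := (∑ t ∈ Finset.range k, a t + ∑' t, b t) / (1 - ρ)) ha
    fun M => ?_
  rw [le_div_iff₀ (sub_pos.2 hρ)]
  have hshift : ∑ t ∈ Finset.range M, a t ≤
      ∑ t ∈ Finset.range k, a t + ∑ t ∈ Finset.range M, a (t + k) := by
    simp_rw [add_comm _ k, ← Finset.sum_range_add]
    exact Finset.sum_le_sum_of_subset_of_nonneg (Finset.range_mono (Nat.le_add_left _ _))
      fun t _ _ => ha t
  have hrec : ∑ t ∈ Finset.range M, a (t + k) ≤
      ρ * ∑ t ∈ Finset.range M, a t + ∑ t ∈ Finset.range M, b t := by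
    rw [Finset.mul_sum, ← Finset.sum_add_distrib]
    exact Finset.sum_le_sum fun t _ => h t
  have hbM : ∑ t ∈ Finset.range M, b t ≤ ∑' t, b t := hbs.sum_le_tsum _ fun t _ => hb t
  linarith

lemma summable_sq_of_delayed_contraction {a b : ℕ → ℝ} {ρ : ℝ} {k : ℕ} (ha : ∀ t, 0 ≤ a t)
    (hρ0 : 0 ≤ ρ) (hρ1 : ρ < 1) (hbs : Summable fun t => b t ^ 2)
    (h : ∀ t, a (t + k) ≤ ρ * a t + b t) : Summable fun t => a t ^ 2 := by
  have hpos : 0 < 1 - ρ := sub_pos.2 hρ1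
  refine summable_of_delayed_contraction (k := k) (b := fun t => b t ^ 2 / (1 - ρ))
    (fun t => sq_nonneg _) (fun t => by positivity) hρ1 (hbs.div_const _) fun t => ?_
  have hconv : ρ * a t ^ 2 + b t ^ 2 / (1 - ρ) - (ρ * a t + b t) ^ 2 =
      ρ / (1 - ρ) * ((1 - ρ) * a t - b t) ^ 2 := by
    field_simp
    ring
  have hrest : 0 ≤ ρ / (1 - ρ) * ((1 - ρ) * a t - b t) ^ 2 := by positivity
  linarith [pow_le_pow_left₀ (ha _) (h t) 2]

lemma summable_sq_sum {κ : Type*} {s : Finset κ} {a : κ → ℕ → ℝ}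
    (ha : ∀ i ∈ s, Summable fun t => a i t ^ 2) : Summable fun t => (∑ i ∈ s, a i t) ^ 2 :=
  ((summable_sum ha).mul_left (s.card : ℝ)).of_nonneg_of_le (fun _ => sq_nonneg _)
    fun _ => sq_sum_le_card_mul_sum_sq

theorem IsUniformlyMixing.summable_diam_sq [Nonempty ι] {η : ℝ} {B : ℕ}
    (hW : IsUniformlyMixing W η B) (hη : 0 < η) {x e : ℕ → ι → V}
    (hx : ∀ t i, x (t + 1) i = ∑ j, W t i j • x t j + e t i)
    (he : ∀ i, Summable fun t => ‖e t i‖ ^ 2) :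
    Summable fun t => Metric.diam (Set.range (x t)) ^ 2 := by
  set k := B * Fintype.card ι
  have hΦ := hW.pow_le_transition hη.le
  have hmass : Fintype.card ι * η ^ k ≤ 1 := by
    have hrow := Finset.card_nsmul_le_sum Finset.univ _ _
      fun j _ => hΦ 0 (Classical.arbitrary ι) j
    rwa [Matrix.sum_row_of_mem_rowStochastic
      (transition_mem_rowStochastic hW.mem_rowStochastic _ _),
      nsmul_eq_mul] at hrow
  have hmass_pos : 0 < Fintype.card ι * η ^ k :=
    mul_pos (Nat.cast_pos.2 Fintype.card_pos) (pow_pos hη k)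
  have herr : Summable fun t => (2 * ∑ τ ∈ Finset.range k, ∑ i, ‖e (t + τ) i‖) ^ 2 := by
    simp_rw [mul_pow]
    exact (summable_sq_sum fun τ _ => summable_sq_sum fun i _ =>
      (summable_nat_add_iff τ).2 (he i)).mul_left _
  exact summable_sq_of_delayed_contraction (fun _ => Metric.diam_nonneg) (sub_nonneg.2 hmass)
    (sub_lt_self _ hmass_pos) herr
    fun t => diam_range_le_of_le_transition hW.mem_rowStochastic hx (hΦ t)

end Consensus

section Measurability

variable {Ω V : Type*} {_ : MeasurableSpace Ω}

lemma measurable_comp_of_continuousOn [TopologicalSpace V] [MeasurableSpace V] [BorelSpace V]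
    {X : Set V} {ψ : V → ℝ} (hψ : ContinuousOn ψ X) {u : Ω → V} (hu : Measurable u)
    (hmem : ∀ ω, u ω ∈ X) : Measurable fun ω => ψ (u ω) :=
  (continuousOn_iff_continuous_domRestrict.1 hψ).measurable.comp (hu.subtype_mk (h := hmem))

lemma stronglyMeasurable_of_forall_mem_isCompact [MetricSpace V] [MeasurableSpace V]
    [BorelSpace V] {X : Set V} (hX : IsCompact X) {u : Ω → V} (hu : Measurable u)
    (hmem : ∀ ω, u ω ∈ X) : StronglyMeasurable u :=
  stronglyMeasurable_iff_measurable_separable.2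
    ⟨hu, hX.isSeparable.mono (Set.range_subset_iff.2 hmem)⟩

lemma measurable_iInf_of_isSeparable [MetricSpace V] {K : Set V}
    (hK : TopologicalSpace.IsSeparable K) {F : Ω → V → ℝ} (hF : ∀ ω, ContinuousOn (F ω) K)
    (hm : ∀ x ∈ K, Measurable fun ω => F ω x) : Measurable fun ω => ⨅ x : K, F ω x := by
  rcases K.eq_empty_or_nonempty with rfl | hne
  · simp only [Real.iInf_of_isEmpty, measurable_const]
  have := hK.separableSpace
  have := hne.to_subtype
  have hdense := TopologicalSpace.denseRange_denseSeq K
  have heq : ∀ ω, ⨅ x : K, F ω x = ⨅ k, F ω (TopologicalSpace.denseSeq K k) := by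
    intro ω
    have hc : Continuous fun x : K => F ω x := continuousOn_iff_continuous_domRestrict.1 (hF ω)
    rw [← hdense.ciInf' hc]
    exact (Set.rangeFactorization_surjective.iInf_comp
      fun x : Set.range (TopologicalSpace.denseSeq K) => F ω x).symm
  simp only [heq]
  exact Measurable.iInf fun k => hm _ (TopologicalSpace.denseSeq K k).2

lemma measurable_of_isMinOn_unique [MetricSpace V] [MeasurableSpace V] [BorelSpace V]
    {X : Set V} (hX : IsCompact X) {F : Ω → V → ℝ} (hF : ∀ ω, ContinuousOn (F ω) X)
    (hm : ∀ x ∈ X, Measurable fun ω => F ω x) {p : Ω → V} (hpX : ∀ ω, p ω ∈ X)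
    (hp : ∀ ω, IsMinOn (F ω) X (p ω)) (huniq : ∀ ω, ∀ x ∈ X, IsMinOn (F ω) X x → x = p ω) :
    Measurable p := by
  refine measurable_of_isClosed fun C hC => ?_
  rcases (X ∩ C).eq_empty_or_nonempty with h0 | h0
  · have : p ⁻¹' C = ∅ := Set.eq_empty_iff_forall_notMem.2 fun ω hω =>
      Set.eq_empty_iff_forall_notMem.1 h0 (p ω) ⟨hpX ω, hω⟩
    exact this ▸ MeasurableSet.empty
  have hK : IsCompact (X ∩ C) := hX.inter_right hC
  have hset : p ⁻¹' C = {ω | ⨅ x : ↥(X ∩ C), F ω x ≤ ⨅ x : X, F ω x} := by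
    ext ω
    rw [Set.mem_preimage, Set.mem_ofPred_eq, (hp ω).iInf_eq (hpX ω)]
    constructor
    · intro hω
      rw [((hp ω).on_subset Set.inter_subset_left).iInf_eq (show p ω ∈ X ∩ C from ⟨hpX ω, hω⟩)]
    · intro hle
      obtain ⟨q, hq, hmin⟩ := hK.exists_isMinOn h0 ((hF ω).mono Set.inter_subset_left)
      rw [hmin.iInf_eq hq] at hle
      exact huniq ω q hq.1 (fun x hx => hle.trans (hp ω hx)) ▸ hq.2
  rw [hset]
  exact measurableSet_le
    (measurable_iInf_of_isSeparable hK.isSeparable (fun ω => (hF ω).mono Set.inter_subset_left)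
      fun x hx => hm x hx.1)
    (measurable_iInf_of_isSeparable hX.isSeparable hF hm)

variable [NormedAddCommGroup V] [NormedSpace ℝ V] {X : Set V} {ψ : V → ℝ}

lemma measurable_bregman (hX : Convex ℝ X) (hψ : ContinuousOn ψ X) {x : V} (hx : x ∈ X)
    {v : Ω → V} (hv : StronglyMeasurable v) (hvX : ∀ ω, v ω ∈ X)
    (hd : ∀ ω, DifferentiableWithinAt ℝ ψ X (v ω)) :
    Measurable fun ω => bregman X ψ x (v ω) := by
  borelize V
  have hψv := measurable_comp_of_continuousOn hψ hv.measurable hvX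
  refine (measurable_const.sub hψv).sub ?_
  let s : ℕ → ℝ := fun k => ((k : ℝ) + 1)⁻¹
  have hs0 : ∀ k, 0 < s k := fun k => by positivity
  have hs1 : ∀ k, s k ≤ 1 := fun k => inv_le_one_of_one_le₀ (by simp)
  have hs : Tendsto s atTop (𝓝[>] 0) := tendsto_inv_atTop_nhdsGT_zero.comp
    (tendsto_atTop_add_const_right _ _ tendsto_natCast_atTop_atTop)
  refine measurable_of_tendsto_metrizable
    (f := fun k ω => (s k)⁻¹ * (ψ (v ω + s k • (x - v ω)) - ψ (v ω))) (fun k => ?_)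
    (tendsto_pi_nhds.2 fun ω => (tendsto_slope_fderivWithin hX hx (hvX ω) (hd ω)).comp hs)
  have hline : Measurable fun ω => v ω + s k • (x - v ω) :=
    (hv.add ((stronglyMeasurable_const.sub hv).const_smul (s k))).measurable
  exact ((measurable_comp_of_continuousOn hψ hline fun ω =>
    hX.add_smul_sub_mem (hvX ω) hx ⟨(hs0 k).le, hs1 k⟩).sub hψv).const_mul _

lemma IsProx.stronglyMeasurable (hX : IsCompact X) (hψ : StrictConvexOn ℝ X ψ)
    (hψc : ContinuousOn ψ X) {v p : Ω → V} {y : Ω → StrongDual ℝ V}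
    (hv : StronglyMeasurable v) (hvX : ∀ ω, v ω ∈ X)
    (hd : ∀ ω, DifferentiableWithinAt ℝ ψ X (v ω)) (hy : StronglyMeasurable y)
    (hp : ∀ ω, IsProx X ψ (v ω) (y ω) (p ω)) : StronglyMeasurable p := by
  borelize V
  refine stronglyMeasurable_of_forall_mem_isCompact hX ?_ fun ω => (hp ω).1
  refine measurable_of_isMinOn_unique hX
    (F := fun ω x' => y ω (v ω - x') + bregman X ψ x' (v ω)) (fun ω => ?_) (fun x hx => ?_)
    (fun ω => (hp ω).1) (fun ω => (hp ω).2) fun ω x hx hmin => IsProx.unique hψ ⟨hx, hmin⟩ (hp ω)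
  · unfold bregman
    exact ContinuousOn.add (by fun_prop) ((hψc.sub continuousOn_const).sub (by fun_prop))
  · have happly : Continuous fun z : StrongDual ℝ V × V => z.1 z.2 := by fun_prop
    exact (happly.comp_stronglyMeasurable
      (hy.prodMk (hv.sub stronglyMeasurable_const))).measurable.add
        (measurable_bregman hψ.1 hψc hx hv hvX hd)

end Measurability

section Convergence

variable {Ω : Type*} {m0 : MeasurableSpace Ω} {P : Measure Ω}

lemma ae_summable_norm_of_summable_integral_norm {ι V : Type*} [Countable ι]
    [NormedAddCommGroup V] {h : ι → Ω → V} (hi : ∀ t, Integrable (h t) P)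
    (hs : Summable fun t => ∫ ω, ‖h t ω‖ ∂P) : ∀ᵐ ω ∂P, Summable fun t => ‖h t ω‖ := by
  refine summable_norm_of_tsum_eLpNorm_ne_top le_rfl (fun t => (hi t).aestronglyMeasurable) ?_
  simp only [eLpNorm_one_eq_lintegral_enorm, ← ofReal_integral_norm_eq_lintegral_enorm (hi _)]
  exact hs.tsum_ofReal_ne_top

lemma integral_mul_eq_zero_of_condExp_eq_zero {m : MeasurableSpace Ω} (hm : m ≤ m0)
    [SigmaFinite (P.trim hm)] {X Y : Ω → ℝ} (hX : StronglyMeasurable[m] X)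
    (hXY : Integrable (X * Y) P) (hY : Integrable Y P) (hc : P[Y | m] =ᵐ[P] 0) :
    ∫ ω, X ω * Y ω ∂P = 0 := by
  change ∫ ω, (X * Y) ω ∂P = 0
  rw [← integral_condExp hm]
  refine integral_eq_zero_of_ae ?_
  filter_upwards [condExp_mul_of_stronglyMeasurable_left hX hXY hY, hc] with ω hpull hω
  rw [hpull, Pi.mul_apply, hω, Pi.zero_apply, mul_zero]

lemma condExp_apply_eq_zero_of_condExp_eq_zero {V : Type*} [NormedAddCommGroup V]
    [NormedSpace ℝ V] {m : MeasurableSpace Ω} {w : Ω → V} {y : Ω → StrongDual ℝ V}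
    (hw : StronglyMeasurable[m] w) (hyw : Integrable (fun ω => y ω (w ω)) P)
    (hy : Integrable y P) (hc : P[y | m] =ᵐ[P] 0) :
    P[fun ω => y ω (w ω) | m] =ᵐ[P] 0 := by
  filter_upwards [condExp_bilin_of_stronglyMeasurable_left (ContinuousLinearMap.apply ℝ ℝ) hw
    hyw hy, hc] with ω hpull hω
  exact hpull.trans (by rw [hω, Pi.zero_apply, map_zero, Pi.zero_apply])

lemma eLpNorm_one_le_of_integral_sq_le [IsProbabilityMeasure P] {f : Ω → ℝ} (hf : MemLp f 2 P)
    {C : ℝ} (hC : ∫ ω, f ω ^ 2 ∂P ≤ C) : eLpNorm f 1 P ≤ ((1 + C) / 2).toNNReal := by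
  have hf1 : Integrable f P := hf.integrable one_le_two
  rw [eLpNorm_one_eq_lintegral_enorm, ← ofReal_integral_norm_eq_lintegral_enorm hf1]
  refine ENNReal.ofReal_le_ofReal ?_
  calc ∫ ω, ‖f ω‖ ∂P ≤ ∫ ω, (1 + f ω ^ 2) / 2 ∂P := by
        refine integral_mono hf1.norm
          (((integrable_const _).add hf.integrable_sq).div_const _) fun ω => ?_
        simp only [Real.norm_eq_abs]
        nlinarith [sq_nonneg (|f ω| - 1), sq_abs (f ω)]
    _ = (1 + ∫ ω, f ω ^ 2 ∂P) / 2 := by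
        rw [integral_div, integral_add (integrable_const _) hf.integrable_sq, integral_const,
          probReal_univ, one_smul]
    _ ≤ (1 + C) / 2 := by linarith

section MartingaleDifference

variable [IsFiniteMeasure P] {ℱ : Filtration ℕ m0} {ε : ℕ → Ω → ℝ}

lemma stronglyMeasurable_sum_range (hm : ∀ t, StronglyMeasurable[ℱ (t + 1)] (ε t)) (T : ℕ) :
    StronglyMeasurable[ℱ T] (∑ t ∈ Finset.range T, ε t) :=
  Finset.stronglyMeasurable_sum _ fun t ht =>
    (hm t).mono (ℱ.mono (Nat.succ_le_of_lt (Finset.mem_range.1 ht)))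

lemma martingale_sum_range (hm : ∀ t, StronglyMeasurable[ℱ (t + 1)] (ε t))
    (hi : ∀ t, Integrable (ε t) P) (hc : ∀ t, P[ε t | ℱ t] =ᵐ[P] 0) :
    Martingale (fun T => ∑ t ∈ Finset.range T, ε t) ℱ P := by
  have hSi : ∀ T, Integrable (∑ t ∈ Finset.range T, ε t) P := fun T =>
    integrable_finsetSum' _ fun t _ => hi t
  refine martingale_nat (stronglyMeasurable_sum_range hm) hSi fun T => ?_
  have hadd := condExp_add (hSi T) (hi T) (ℱ T)
  rw [condExp_of_stronglyMeasurable (ℱ.le T) (stronglyMeasurable_sum_range hm T) (hSi T)] at hadd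
  rw [Finset.sum_range_succ]
  filter_upwards [hadd, hc T] with ω hω hcω
  rw [hω, Pi.add_apply, hcω, Pi.zero_apply, add_zero]

lemma integral_sq_sum_range_eq (hm : ∀ t, StronglyMeasurable[ℱ (t + 1)] (ε t))
    (h2 : ∀ t, MemLp (ε t) 2 P) (hc : ∀ t, P[ε t | ℱ t] =ᵐ[P] 0) (T : ℕ) :
    ∫ ω, (∑ t ∈ Finset.range T, ε t) ω ^ 2 ∂P = ∑ t ∈ Finset.range T, ∫ ω, ε t ω ^ 2 ∂P := by
  induction T with
  | zero => simp
  | succ T ih =>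
    set S := ∑ t ∈ Finset.range T, ε t
    have hS2 : MemLp S 2 P := memLp_finsetSum' _ fun t _ => h2 t
    have hSε : Integrable (S * ε T) P := hS2.integrable_mul (h2 T)
    have horth : ∫ ω, S ω * ε T ω ∂P = 0 := integral_mul_eq_zero_of_condExp_eq_zero (ℱ.le T)
      (stronglyMeasurable_sum_range hm T) hSε ((h2 T).integrable one_le_two) (hc T)
    rw [Finset.sum_range_succ, Finset.sum_range_succ, ← ih]
    calc ∫ ω, (S + ε T) ω ^ 2 ∂P
        = ∫ ω, (S ω ^ 2 + ε T ω ^ 2 + 2 * (S ω * ε T ω)) ∂P := by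
          refine integral_congr_ae (Eventually.of_forall fun ω => ?_)
          simp only [Pi.add_apply]
          ring
      _ = ∫ ω, S ω ^ 2 ∂P + ∫ ω, ε T ω ^ 2 ∂P + 2 * ∫ ω, S ω * ε T ω ∂P := by
          rw [integral_add, integral_add hS2.integrable_sq (h2 T).integrable_sq,
            integral_const_mul]
          exacts [hS2.integrable_sq.add (h2 T).integrable_sq, hSε.const_mul 2]
      _ = ∫ ω, S ω ^ 2 ∂P + ∫ ω, ε T ω ^ 2 ∂P := by rw [horth, mul_zero, add_zero]

end MartingaleDifference

lemma ae_tendsto_sum_of_martingaleDifference [IsProbabilityMeasure P] {ℱ : Filtration ℕ m0}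
    {ε : ℕ → Ω → ℝ} (hm : ∀ t, StronglyMeasurable[ℱ (t + 1)] (ε t)) (h2 : ∀ t, MemLp (ε t) 2 P)
    (hc : ∀ t, P[ε t | ℱ t] =ᵐ[P] 0) (hs : Summable fun t => ∫ ω, ε t ω ^ 2 ∂P) :
    ∀ᵐ ω ∂P, ∃ c, Tendsto (fun T => ∑ t ∈ Finset.range T, ε t ω) atTop (𝓝 c) := by
  have hsq : ∀ T, ∫ ω, (∑ t ∈ Finset.range T, ε t) ω ^ 2 ∂P ≤ ∑' t, ∫ ω, ε t ω ^ 2 ∂P := by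
    intro T
    rw [integral_sq_sum_range_eq hm h2 hc]
    exact hs.sum_le_tsum _ fun t _ => integral_nonneg fun ω => sq_nonneg _
  have hmart := martingale_sum_range hm (fun t => (h2 t).integrable one_le_two) hc
  have hbdd := fun T =>
    eLpNorm_one_le_of_integral_sq_le (memLp_finsetSum' _ fun t _ => h2 t) (hsq T)
  filter_upwards [hmart.submartingale.exists_ae_tendsto_of_bdd hbdd] with ω hω
  simpa only [Finset.sum_apply] using hω

-- The pathwise part of the Robbins–Siegmund theorem.
lemma exists_tendsto_of_descent {V a c m : ℕ → ℝ} (hV : ∀ t, 0 ≤ V t) (ha : ∀ t, 0 ≤ a t)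
    (hc : Summable c) (hm : ∃ l, Tendsto (fun T => ∑ t ∈ Finset.range T, m t) atTop (𝓝 l))
    (h : ∀ t, V (t + 1) ≤ V t - a t + c t + m t) :
    (∃ l, Tendsto V atTop (𝓝 l)) ∧ Summable a := by
  obtain ⟨lm, hm⟩ := hm
  set Z : ℕ → ℝ := fun T => ∑ t ∈ Finset.range T, c t + ∑ t ∈ Finset.range T, m t with hZdef
  have hZ : Tendsto Z atTop (𝓝 (∑' t, c t + lm)) := hc.hasSum.tendsto_sum_nat.add hm
  obtain ⟨K, hK⟩ := hZ.bddAbove_range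
  replace hK : ∀ T, Z T ≤ K := fun T => hK ⟨T, rfl⟩
  set Y : ℕ → ℝ := fun T => V T - Z T + ∑ t ∈ Finset.range T, a t with hYdef
  have hY : Antitone Y := antitone_nat_of_succ_le fun T => by
    simp only [hYdef, hZdef, Finset.sum_range_succ]
    linarith [h T]
  have hVa : ∀ T, V T + ∑ t ∈ Finset.range T, a t ≤ Y T + K := fun T => by
    simp only [hYdef]
    linarith [hK T]
  have hsa : Summable a :=
    summable_of_sum_range_le (c := Y 0 + K) ha fun T => by
      linarith [hV T, hVa T, hY (Nat.zero_le T)]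
  have hYb : BddBelow (Set.range Y) := by
    refine ⟨-K, Set.forall_mem_range.2 fun T => ?_⟩
    linarith [hV T, hVa T, Finset.sum_nonneg fun t (_ : t ∈ Finset.range T) => ha t]
  refine ⟨⟨_, (((tendsto_atTop_ciInf hY hYb).add hZ).sub hsa.hasSum.tendsto_sum_nat).congr
    fun T => ?_⟩, hsa⟩
  simp only [hYdef]
  ring

lemma exists_subseq_tendsto_zero {a b : ℕ → ℝ} (ha : ∀ t, 0 ≤ a t) (hb : ∀ t, 0 ≤ b t)
    (hab : Summable fun t => a t * b t) (hna : ¬ Summable a) :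
    ∃ φ : ℕ → ℕ, StrictMono φ ∧ Tendsto (fun k => b (φ k)) atTop (𝓝 0) := by
  have hfreq : ∀ k : ℕ, ∃ᶠ t in atTop, b t < ((k : ℝ) + 1)⁻¹ := by
    intro k hk
    obtain ⟨N, hN⟩ := eventually_atTop.1 hk
    have hk0 : (0 : ℝ) < (k : ℝ) + 1 := by positivity
    refine hna ((summable_nat_add_iff N).1 ?_)
    refine (((summable_nat_add_iff N).2 hab).mul_left ((k : ℝ) + 1)).of_nonneg_of_le
      (fun t => ha _) fun t => ?_
    have hone : 1 ≤ ((k : ℝ) + 1) * b (t + N) :=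
      (inv_le_iff_one_le_mul₀' hk0).1 (not_lt.1 (hN (t + N) (Nat.le_add_left _ _)))
    calc a (t + N) ≤ a (t + N) * (((k : ℝ) + 1) * b (t + N)) := le_mul_of_one_le_right (ha _) hone
      _ = ((k : ℝ) + 1) * (a (t + N) * b (t + N)) := by ring
  obtain ⟨φ, hφ, h⟩ := extraction_forall_of_frequently hfreq
  exact ⟨φ, hφ, squeeze_zero (fun k => hb _) (fun k => (h k).le) (tendsto_inv_atTop_zero.comp
    (tendsto_atTop_add_const_right _ _ tendsto_natCast_atTop_atTop))⟩

end Convergence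

section AgentAverage

variable {n : Fin 2 → ℕ} {a b : ∀ l, Fin (n l) → ℝ}

/-- The sum over the two subnetworks of the average over the agents, as a functional of the
quantities attached to the agents. -/
noncomputable def agentAverage (n : Fin 2 → ℕ) : (∀ l, Fin (n l) → ℝ) →L[ℝ] ℝ :=
  ∑ l, (1 / (n l : ℝ)) • ∑ i, (ContinuousLinearMap.proj i).comp (ContinuousLinearMap.proj l)

lemma agentAverage_apply (a : ∀ l, Fin (n l) → ℝ) :
    agentAverage n a = ∑ l, (1 / (n l : ℝ)) * ∑ i, a l i := by
  simp [agentAverage]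

lemma agentAverage_mono (h : ∀ l, ∑ i, a l i ≤ ∑ i, b l i) :
    agentAverage n a ≤ agentAverage n b := by
  simp only [agentAverage_apply]
  exact Finset.sum_le_sum fun l _ => mul_le_mul_of_nonneg_left (h l) (by positivity)

lemma agentAverage_nonneg (h : ∀ l i, 0 ≤ a l i) : 0 ≤ agentAverage n a := by
  rw [← map_zero (agentAverage n)]
  exact agentAverage_mono fun l => Finset.sum_le_sum fun i _ => h l i

lemma le_mul_agentAverage (h : ∀ l i, 0 ≤ a l i) (l : Fin 2) (i : Fin (n l)) :
    a l i ≤ n l * agentAverage n a := by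
  have hn : (0 : ℝ) < n l := by exact_mod_cast i.pos
  rw [← inv_mul_le_iff₀ hn, ← one_div, agentAverage_apply]
  calc 1 / (n l : ℝ) * a l i ≤ 1 / (n l : ℝ) * ∑ i, a l i := by
        gcongr
        exact Finset.single_le_sum (fun i _ => h l i) (Finset.mem_univ i)
    _ ≤ ∑ l, 1 / (n l : ℝ) * ∑ i, a l i :=
        Finset.single_le_sum (f := fun l => 1 / (n l : ℝ) * ∑ i, a l i)
          (fun l _ => mul_nonneg (by positivity) (Finset.sum_nonneg fun i _ => h l i))
          (Finset.mem_univ l)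

end AgentAverage

lemma convexOn_finsetSum {ι V : Type*} [AddCommGroup V] [Module ℝ V] {X : Set V} (s : Finset ι)
    {h : ι → V → ℝ} (hX : Convex ℝ X) (hh : ∀ i ∈ s, ConvexOn ℝ X (h i)) :
    ConvexOn ℝ X fun a => ∑ i ∈ s, h i a := by
  simp only [← Finset.sum_apply]
  exact Finset.sum_induction h (ConvexOn ℝ X) (fun _ _ => ConvexOn.add) (convexOn_const 0 hX) hh

lemma profile_ext {E : Fin 2 → Type*} {x y : ∀ k, E k} (h0 : x 0 = y 0) (h1 : x 1 = y 1) :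
    x = y := funext (Fin.forall_fin_two.2 ⟨h0, h1⟩)

lemma update_one_eq_update_zero {E : Fin 2 → Type*} (x y : ∀ k, E k) :
    Function.update x 1 (y 1) = Function.update y 0 (x 0) :=
  profile_ext (by simp) (by simp)

namespace Game

variable {Ω : Type*} [MeasurableSpace Ω] {P : Measure Ω}
  {E : Fin 2 → Type*} [∀ l, NormedAddCommGroup (E l)] [∀ l, NormedSpace ℝ (E l)]
  {n : Fin 2 → ℕ} {d : ℕ} {Γ : Game E P n d} {x y z : ∀ k, E k}

lemma update_mem (hx : x ∈ Set.univ.pi Γ.X) {l : Fin 2} {a : E l} (ha : a ∈ Γ.X l) :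
    Function.update x l a ∈ Set.univ.pi Γ.X :=
  (Set.update_mem_pi_iff_of_mem hx).2 fun _ => ha

variable (Γ) in
lemma continuousOn_U : ContinuousOn Γ.U (Set.univ.pi Γ.X) :=
  (continuousOn_finsetSum _ fun i _ => Γ.cost_continuous 0 i).const_mul _

lemma continuousOn_U_update (hx : x ∈ Set.univ.pi Γ.X) (l : Fin 2) :
    ContinuousOn (fun a => Γ.U (Function.update x l a)) (Γ.X l) :=
  Γ.continuousOn_U.comp (continuous_const.update l continuous_id).continuousOn
    fun _ ha => update_mem hx ha

lemma convexOn_U_update_zero (hx : x ∈ Set.univ.pi Γ.X) :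
    ConvexOn ℝ (Γ.X 0) fun a => Γ.U (Function.update x 0 a) := by
  have hsum := convexOn_finsetSum Finset.univ (Γ.convex 0)
    fun i _ => Γ.cost_convex 0 i x hx
  exact hsum.smul (by positivity)

lemma concaveOn_U_update_one (hx : x ∈ Set.univ.pi Γ.X) :
    ConcaveOn ℝ (Γ.X 1) fun a => Γ.U (Function.update x 1 a) := by
  have hsum := convexOn_finsetSum Finset.univ (Γ.convex 1)
    fun i _ => (Γ.cost_concave 0 i 1 one_ne_zero x hx).neg
  refine ((hsum.smul (c := 1 / (n 0 : ℝ)) (by positivity)).neg).congr fun a _ => ?_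
  simp [U, f]

variable (Γ) in
theorem exists_isNash : ∃ x, Γ.IsNash x := by
  obtain ⟨c, hc⟩ : (Set.univ.pi Γ.X).Nonempty := Set.univ_pi_nonempty_iff.2 Γ.nonempty
  have hcomm : ∀ a b, Function.update (Function.update c 1 b) 0 a =
      Function.update (Function.update c 0 a) 1 b := fun a b =>
    Function.update_comm one_ne_zero b a c
  obtain ⟨a, ha, b, hb, hab⟩ := Sion.exists_isSaddlePointOn'
    (f := fun a b => Γ.U (Function.update (Function.update c 1 b) 0 a))
    (Γ.nonempty 0) (Γ.compact 0)
    (fun b hb => (continuousOn_U_update (update_mem hc hb) 0).lowerSemicontinuousOn)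
    (fun b hb => (convexOn_U_update_zero (update_mem hc hb)).quasiconvexOn)
    (Γ.convex 1) (Γ.compact 1)
    (fun a ha => by
      simpa only [hcomm] using (continuousOn_U_update (update_mem hc ha) 1).upperSemicontinuousOn)
    (fun a ha => by
      simpa only [hcomm] using (concaveOn_U_update_one (update_mem hc ha)).quasiconcaveOn)
    (Γ.convex 0) (Γ.nonempty 1)
  refine ⟨_, update_mem (update_mem hc hb) ha, fun y hy => ?_, fun y hy => ?_⟩
  · rw [hcomm, Function.update_idem, ← hcomm, ← hcomm]
    exact hab a ha y hy
  · rw [Function.update_idem]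
    exact hab y hy b hb

/-- The duality gap of `z` measured against the profile `x`, which at a Nash equilibrium `x`
bounds the suboptimality of both components of `z`. -/
noncomputable def gap (Γ : Game E P n d) (x z : ∀ k, E k) : ℝ :=
  Γ.U (Function.update x 0 (z 0)) - Γ.U (Function.update x 1 (z 1))

lemma continuousOn_gap (hx : x ∈ Set.univ.pi Γ.X) :
    ContinuousOn (Γ.gap x) (Set.univ.pi Γ.X) :=
  have hcomp : ∀ l, ContinuousOn (fun z : ∀ k, E k => Γ.U (Function.update x l (z l)))
      (Set.univ.pi Γ.X) := fun l =>
    (continuousOn_U_update hx l).comp (continuous_apply l).continuousOn fun _ hz => hz l trivial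
  (hcomp 0).sub (hcomp 1)

-- The zero-sum identity at `z` turns the two summands of the average into the two terms of the gap.
lemma agentAverage_cost_sub (hx : x ∈ Set.univ.pi Γ.X) (hz : z ∈ Set.univ.pi Γ.X) :
    agentAverage n (fun l i => Γ.f l i (Function.update z l (x l)) - Γ.f l i z) =
      -Γ.gap x z := by
  have hzero := Γ.zero_sum z hz
  have hzero' := Γ.zero_sum _ (update_mem hz (hx 1 trivial))
  simp only [agentAverage_apply, Fin.sum_univ_two, Finset.sum_sub_distrib, mul_sub, gap, U]
  rw [update_one_eq_update_zero x z, ← update_one_eq_update_zero z x]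
  unfold f
  linarith

namespace IsNash

lemma gap_nonneg (hx : Γ.IsNash x) (hz : z ∈ Set.univ.pi Γ.X) : 0 ≤ Γ.gap x z :=
  sub_nonneg.2 ((hx.2.1 _ (hz 1 trivial)).trans (hx.2.2 _ (hz 0 trivial)))

lemma eq_of_gap_nonpos (hU : Γ.StrictConvexConcave) (hx : Γ.IsNash x)
    (hz : z ∈ Set.univ.pi Γ.X) (h : Γ.gap x z ≤ 0) : z = x := by
  have hmax : IsMaxOn (fun a => Γ.U (Function.update x 1 a)) (Γ.X 1) (x 1) := fun a ha => by
    simpa using hx.2.1 a ha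
  have hmin : IsMinOn (fun a => Γ.U (Function.update x 0 a)) (Γ.X 0) (x 0) := fun a ha => by
    simpa using hx.2.2 a ha
  have hz1 := hx.2.1 _ (hz 1 trivial)
  have hz0 := hx.2.2 _ (hz 0 trivial)
  unfold gap at h
  refine profile_ext ?_ ?_
  · refine (hU x hx.1).1.eq_of_isMinOn (fun a ha => ?_) hmin (hz 0 trivial) (hx.1 0 trivial)
    exact (show Γ.U (Function.update x 0 (z 0)) ≤ Γ.U x by linarith).trans (hx.2.2 a ha)
  · refine (hU x hx.1).2.eq_of_isMaxOn (fun a ha => ?_) hmax (hz 1 trivial) (hx.1 1 trivial)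
    exact (hx.2.1 a ha).trans (show Γ.U x ≤ Γ.U (Function.update x 1 (z 1)) by linarith)

lemma unique (hU : Γ.StrictConvexConcave) (hx : Γ.IsNash x) (hy : Γ.IsNash y) : y = x := by
  refine hx.eq_of_gap_nonpos hU hy.1 ?_
  have hy1 := hy.2.1 _ (hx.1 1 trivial)
  have hy0 := hy.2.2 _ (hx.1 0 trivial)
  rw [update_one_eq_update_zero] at hy1
  rw [← update_one_eq_update_zero] at hy0
  exact sub_nonpos.2 (hy1.trans hy0)

end IsNash

end Game

namespace Network

variable {n : Fin 2 → ℕ} (N : Network n)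

lemma weight_nonneg (l k : Fin 2) (t : ℕ) (i : Fin (n l)) (j : Fin (n k)) :
    0 ≤ N.W l k t i j := by
  rcases eq_or_ne k l with rfl | h
  · by_cases hG : (N.G k t).Adj j i
    · exact N.η_pos.le.trans (N.weight_ge k t i j hG)
    · exact (N.weight_zero k t i j hG).ge
  · exact N.cross_nonneg l k t i j h

lemma exists_isUniformlyMixing (l : Fin 2) : ∃ B, IsUniformlyMixing (N.W l l) N.η B := by
  obtain ⟨B, -, hB⟩ := N.jointly_connected l
  exact ⟨B, fun t => Matrix.mem_rowStochastic_iff_sum.2 ⟨N.weight_nonneg l l t, N.row_sum l l t⟩,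
    fun t i => N.weight_ge l t i i (N.self_loop l t i),
    fun s i j => Relation.ReflTransGen.mono (fun a b ⟨t, hst, hts, hab⟩ =>
      ⟨t, hst, hts, N.weight_ge l t b a hab⟩) i j (hB s i j)⟩

end Network

lemma Regularizer.Reciprocal.convex_dom {V : Type*} [NormedAddCommGroup V] [NormedSpace ℝ V]
    {X : Set V} {R : Regularizer X} (hR : R.Reciprocal) : Convex ℝ R.dom := by
  rcases R.dom.eq_empty_or_nonempty with h | ⟨x, hx⟩
  · exact h ▸ convex_empty
  · exact (hR.convex_right x (R.dom_subset hx)).1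

section

variable {Ω : Type*} [MeasurableSpace Ω] {P : Measure Ω}
  {E : Fin 2 → Type*} [∀ l, NormedAddCommGroup (E l)] [∀ l, NormedSpace ℝ (E l)]
  {n : Fin 2 → ℕ} {d : ℕ}

lemma Game.sum_one_div_agents (Γ : Game E P n d) (k : Fin 2) :
    ∑ _j : Fin (n k), (1 / (n k : ℝ)) = 1 := by
  have : (n k : ℝ) ≠ 0 := by exact_mod_cast (Γ.agents_pos k).ne'
  simp [this]

namespace Run

variable [∀ l, MeasurableSpace (E l)] {Γ : Game E P n d} {N : Network n}
  {R : ∀ l, Regularizer (Γ.X l)} {α : ℕ → ℝ} (r : Run Γ N R α)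

/-- The point at which agent `i` of subnetwork `l` samples its subgradient at time `t`. -/
def point (l : Fin 2) (i : Fin (n l)) (t : ℕ) (ω : Ω) : ∀ k, E k :=
  estimate N t (fun k j => r.x k j t ω) l i

/-- The profile of mean strategies of the two subnetworks. -/
noncomputable def mean (t : ℕ) (ω : Ω) : ∀ k, E k :=
  fun k => ∑ j, (1 / (n k : ℝ)) • r.x k j t ω

/-- The consensus error: the sum of the diameters of the two sets of strategies. -/
noncomputable def disagreement (t : ℕ) (ω : Ω) : ℝ :=
  ∑ k, Metric.diam (Set.range fun j => r.x k j t ω)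

section Feasibility

variable (hdom : ∀ l, Convex ℝ (R l).dom)
include hdom

lemma mem_dom (t : ℕ) (ω : Ω) (l : Fin 2) (i : Fin (n l)) : r.x l i t ω ∈ (R l).dom := by
  induction t generalizing l i with
  | zero => exact r.init_mem l i ω
  | succ t ih =>
    refine (R l).prox_mem _ ?_ _ _ (r.step l i t ω)
    exact (hdom l).sum_mem (fun j _ => N.weight_nonneg l l t i j) (N.row_sum l l t i)
      fun j _ => ih l j

lemma point_mem_dom (l : Fin 2) (i : Fin (n l)) (t : ℕ) (ω : Ω) (k : Fin 2) :
    r.point l i t ω k ∈ (R k).dom :=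
  (hdom k).sum_mem (fun j _ => N.weight_nonneg l k t i j) (N.row_sum l k t i)
    fun j _ => r.mem_dom hdom t ω k j

lemma point_mem (l : Fin 2) (i : Fin (n l)) (t : ℕ) (ω : Ω) :
    r.point l i t ω ∈ Set.univ.pi Γ.X :=
  fun k _ => (R k).dom_subset (r.point_mem_dom hdom l i t ω k)

lemma mean_mem (t : ℕ) (ω : Ω) : r.mean t ω ∈ Set.univ.pi Γ.X :=
  fun k _ => (Γ.convex k).sum_mem (fun _ _ => by positivity) (Γ.sum_one_div_agents k)
    fun j _ => (R k).dom_subset (r.mem_dom hdom t ω k j)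

lemma differentiableWithinAt_ψ (t : ℕ) (ω : Ω) (l : Fin 2) (i : Fin (n l)) :
    DifferentiableWithinAt ℝ (R l).ψ (Γ.X l) (r.x l i t ω) :=
  (R l).differentiable _ (r.mem_dom hdom t ω l i)

lemma differentiableWithinAt_ψ_point (t : ℕ) (ω : Ω) (l : Fin 2) (i : Fin (n l)) :
    DifferentiableWithinAt ℝ (R l).ψ (Γ.X l) (r.point l i t ω l) :=
  (R l).differentiable _ (r.point_mem_dom hdom l i t ω l)

end Feasibility

section Consensus

lemma norm_point_sub_mean_le (l : Fin 2) (i : Fin (n l)) (t : ℕ) (ω : Ω) (k : Fin 2) :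
    ‖r.point l i t ω k - r.mean t ω k‖ ≤ Metric.diam (Set.range fun j => r.x k j t ω) := by
  rw [← dist_eq_norm]
  exact dist_sum_smul_le_diam _ (fun j => N.weight_nonneg l k t i j) (fun _ => by positivity)
    (N.row_sum l k t i) (Γ.sum_one_div_agents k)

lemma norm_sub_mean_le (t : ℕ) (ω : Ω) (k : Fin 2) (i : Fin (n k)) :
    ‖r.x k i t ω - r.mean t ω k‖ ≤ Metric.diam (Set.range fun j => r.x k j t ω) := by
  have h := dist_sum_smul_le_diam (fun j => r.x k j t ω) (p := Pi.single i 1)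
    (q := fun _ => 1 / (n k : ℝ)) (single_mem_stdSimplex ℝ i).1 (fun _ => by positivity)
    (single_mem_stdSimplex ℝ i).2 (Γ.sum_one_div_agents k)
  simpa [Pi.single_apply, mean, dist_eq_norm] using h

variable (hdom : ∀ l, Convex ℝ (R l).dom)
include hdom

lemma norm_step_le (l : Fin 2) (i : Fin (n l)) (t : ℕ) (ω : Ω) :
    ‖r.x l i (t + 1) ω - r.point l i t ω l‖ ≤ ‖α t • r.ghat l i t ω‖ := by
  have h := (r.step l i t ω).mul_norm_sub_le (R l).strongConvexOn
    ((R l).dom_subset (r.point_mem_dom hdom l i t ω l))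
    (r.differentiableWithinAt_ψ hdom (t + 1) ω l i) (r.differentiableWithinAt_ψ_point hdom t ω l i)
  rwa [one_mul, norm_neg] at h

variable {ω : Ω} (hs : ∀ l i, Summable fun t => ‖α t • r.ghat l i t ω‖ ^ 2)
include hs

lemma summable_diam_sq (l : Fin 2) :
    Summable fun t => Metric.diam (Set.range fun j => r.x l j t ω) ^ 2 := by
  obtain ⟨B, hB⟩ := N.exists_isUniformlyMixing l
  have : Nonempty (Fin (n l)) := ⟨⟨0, Γ.agents_pos l⟩⟩
  refine hB.summable_diam_sq N.η_pos (x := fun t i => r.x l i t ω)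
    (e := fun t i => r.x l i (t + 1) ω - r.point l i t ω l) (fun t i => ?_) fun i => ?_
  · simp only [point, estimate, add_sub_cancel]
  · exact (hs l i).of_nonneg_of_le (fun t => sq_nonneg _) fun t =>
      pow_le_pow_left₀ (norm_nonneg _) (r.norm_step_le hdom l i t ω) 2

lemma summable_disagreement_sq : Summable fun t => r.disagreement t ω ^ 2 :=
  summable_sq_sum fun l _ => r.summable_diam_sq hdom hs l

lemma tendsto_sub_mean_zero (l : Fin 2) (i : Fin (n l)) :
    Tendsto (fun t => r.x l i t ω - r.mean t ω l) atTop (𝓝 0) := by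
  have hdiam := (r.summable_diam_sq hdom hs l).tendsto_atTop_zero.sqrt
  simp only [Real.sqrt_sq Metric.diam_nonneg, Real.sqrt_zero] at hdiam
  exact squeeze_zero_norm (fun t => r.norm_sub_mean_le t ω l i) hdiam

end Consensus

section Descent

/-- The averaged Bregman divergence from the strategies at time `t` to the profile `z`, the
Lyapunov function of the convergence proof. -/
noncomputable def divergence (z : ∀ k, E k) (t : ℕ) (ω : Ω) : ℝ :=
  agentAverage n fun l i => bregman (Γ.X l) (R l).ψ (z l) (r.x l i t ω)

/-- The part of the descent inequality of an agent caused by consensus errors and by the size of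
the sampled subgradient. -/
noncomputable def perturbation (L : ℝ) (t : ℕ) (ω : Ω) (l : Fin 2) (i : Fin (n l)) : ℝ :=
  α t * (2 * L * r.disagreement t ω) + ‖α t • r.ghat l i t ω‖ ^ 2 / 2

/-- The sampling noise in the descent inequality of an agent, a martingale difference. -/
def noise (g : ∀ l, Fin (n l) → ℕ → Ω → StrongDual ℝ (E l)) (z : ∀ k, E k) (t : ℕ) (ω : Ω)
    (l : Fin 2) (i : Fin (n l)) : ℝ :=
  α t * (r.ghat l i t ω - g l i t ω) (z l - r.point l i t ω l)

variable {r}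

lemma sum_bregman_point_le (hR : ∀ l, (R l).Reciprocal) {l : Fin 2} {z : E l} (hz : z ∈ Γ.X l)
    (t : ℕ) (ω : Ω) :
    ∑ i, bregman (Γ.X l) (R l).ψ z (r.point l i t ω l) ≤
      ∑ i, bregman (Γ.X l) (R l).ψ z (r.x l i t ω) :=
  calc ∑ i, bregman (Γ.X l) (R l).ψ z (r.point l i t ω l)
      ≤ ∑ i, ∑ j, N.W l l t i j * bregman (Γ.X l) (R l).ψ z (r.x l j t ω) :=
        Finset.sum_le_sum fun i _ => ((hR l).convex_right z hz).map_sum_le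
          (fun j _ => N.weight_nonneg l l t i j) (N.row_sum l l t i)
          fun j _ => r.mem_dom (fun l => (hR l).convex_dom) t ω l j
    _ = ∑ i, bregman (Γ.X l) (R l).ψ z (r.x l i t ω) := by
        rw [Finset.sum_comm]
        simp only [← Finset.sum_mul, N.col_sum, one_mul]

section

variable (hdom : ∀ l, Convex ℝ (R l).dom) {L : ℝ}
  {g : ∀ l, Fin (n l) → ℕ → Ω → StrongDual ℝ (E l)} (hg : r.IsCostSubgradient L g)
  (hLip : Γ.LipschitzCosts L) {z : ∀ k, E k} (hz : z ∈ Set.univ.pi Γ.X)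
include hdom hg hLip hz

lemma subgradient_apply_le (l : Fin 2) (i : Fin (n l)) (t : ℕ) (ω : Ω) :
    g l i t ω (z l - r.point l i t ω l) ≤
      Γ.f l i (Function.update (r.mean t ω) l (z l)) - Γ.f l i (r.mean t ω) +
        2 * L * r.disagreement t ω := by
  have hL : 0 ≤ L := (norm_nonneg _).trans (hg l i t ω).2
  have hp := r.point_mem hdom l i t ω
  have hm := r.mean_mem hdom t ω
  have hsub : Γ.f l i (r.point l i t ω) + g l i t ω (z l - r.point l i t ω l) ≤
      Γ.f l i (Function.update (r.point l i t ω) l (z l)) := by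
    have h := (hg l i t ω).1 (z l) (hz l trivial)
    simp only [Function.update_eq_self] at h
    exact h
  have hlip : ∀ {x y : ∀ k, E k}, x ∈ Set.univ.pi Γ.X → y ∈ Set.univ.pi Γ.X →
      (∀ k, ‖x k - y k‖ ≤ Metric.diam (Set.range fun j => r.x k j t ω)) →
      |Γ.f l i x - Γ.f l i y| ≤ L * r.disagreement t ω := fun hx hy hxy => by
    refine (hLip l i _ hx _ hy).trans (mul_le_mul_of_nonneg_left ?_ hL)
    rw [disagreement, Fin.sum_univ_two]
    exact add_le_add (hxy 0) (hxy 1)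
  have hpoint := abs_le.1 (hlip hp hm (r.norm_point_sub_mean_le l i t ω))
  have hupdate := abs_le.1 (hlip (Game.update_mem hp (hz l trivial))
    (Game.update_mem hm (hz l trivial)) fun k => by
      rcases eq_or_ne k l with rfl | h
      · simpa using Metric.diam_nonneg
      · simpa [h] using r.norm_point_sub_mean_le l i t ω k)
  linarith

lemma bregman_succ_le (hα : ∀ t, 0 ≤ α t) (l : Fin 2) (i : Fin (n l)) (t : ℕ) (ω : Ω) :
    bregman (Γ.X l) (R l).ψ (z l) (r.x l i (t + 1) ω) ≤
      bregman (Γ.X l) (R l).ψ (z l) (r.point l i t ω l) +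
      α t * (Γ.f l i (Function.update (r.mean t ω) l (z l)) - Γ.f l i (r.mean t ω)) +
      r.perturbation L t ω l i + r.noise g z t ω l i := by
  have hprox := (r.step l i t ω).bregman_le zero_lt_one (R l).strongConvexOn
    ((R l).dom_subset (r.point_mem_dom hdom l i t ω l)) (hz l trivial)
    (r.differentiableWithinAt_ψ hdom (t + 1) ω l i) (r.differentiableWithinAt_ψ_point hdom t ω l i)
  rw [norm_neg, neg_apply, smul_apply, smul_eq_mul, mul_one, sub_neg_eq_add] at hprox
  have hsub := mul_le_mul_of_nonneg_left (subgradient_apply_le hdom hg hLip hz l i t ω) (hα t)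
  rw [perturbation, noise, sub_apply]
  change _ ≤ bregman (Γ.X l) (R l).ψ (z l) (r.point l i t ω l) +
    α t * r.ghat l i t ω (z l - r.point l i t ω l) + _ at hprox
  linarith

end

lemma divergence_succ_le (hR : ∀ l, (R l).Reciprocal) {L : ℝ}
    {g : ∀ l, Fin (n l) → ℕ → Ω → StrongDual ℝ (E l)} (hg : r.IsCostSubgradient L g)
    (hLip : Γ.LipschitzCosts L) {z : ∀ k, E k} (hz : z ∈ Set.univ.pi Γ.X) (hα : ∀ t, 0 ≤ α t)
    (t : ℕ) (ω : Ω) :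
    r.divergence z (t + 1) ω ≤ r.divergence z t ω - α t * Γ.gap z (r.mean t ω) +
      agentAverage n (r.perturbation L t ω) + agentAverage n (r.noise g z t ω) := by
  have hdom := fun l => (hR l).convex_dom
  set D : ∀ l, Fin (n l) → ℝ := fun l i => bregman (Γ.X l) (R l).ψ (z l) (r.point l i t ω l)
  set C : ∀ l, Fin (n l) → ℝ := fun l i =>
    Γ.f l i (Function.update (r.mean t ω) l (z l)) - Γ.f l i (r.mean t ω)
  calc r.divergence z (t + 1) ω
      ≤ agentAverage n (D + α t • C + r.perturbation L t ω + r.noise g z t ω) :=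
        agentAverage_mono fun l => Finset.sum_le_sum fun i _ =>
          bregman_succ_le hdom hg hLip hz hα l i t ω
    _ = agentAverage n D - α t * Γ.gap z (r.mean t ω) + agentAverage n (r.perturbation L t ω) +
          agentAverage n (r.noise g z t ω) := by
        simp only [map_add, map_smul, smul_eq_mul]
        rw [Game.agentAverage_cost_sub hz (r.mean_mem hdom t ω)]
        ring
    _ ≤ _ := by
        gcongr
        exact agentAverage_mono fun l => sum_bregman_point_le hR (hz l trivial) t ω

end Descent

end Run

end

lemma summable_mul_of_summable_sq {ι : Type*} {a b : ι → ℝ} (ha : Summable fun t => a t ^ 2)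
    (hb : Summable fun t => b t ^ 2) : Summable fun t => a t * b t :=
  (ha.add hb).of_norm_bounded fun t => by
    rw [Real.norm_eq_abs, abs_mul]
    nlinarith [sq_nonneg (|a t| - |b t|), sq_abs (a t), sq_abs (b t), sq_nonneg (a t)]

namespace Run

variable {Ω : Type*} [MeasurableSpace Ω] {P : Measure Ω}
  {E : Fin 2 → Type*} [∀ l, NormedAddCommGroup (E l)] [∀ l, NormedSpace ℝ (E l)]
  [∀ l, MeasurableSpace (E l)] {n : Fin 2 → ℕ} {d : ℕ} {Γ : Game E P n d} {N : Network n}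
  {R : ∀ l, Regularizer (Γ.X l)} {α : ℕ → ℝ} {r : Run Γ N R α} {ω : Ω}

lemma summable_perturbation (hdom : ∀ l, Convex ℝ (R l).dom) (hα_sq : Summable fun t => α t ^ 2)
    (hs : ∀ l i, Summable fun t => ‖α t • r.ghat l i t ω‖ ^ 2) (L : ℝ) (l : Fin 2)
    (i : Fin (n l)) : Summable fun t => r.perturbation L t ω l i := by
  have hconsensus := summable_mul_of_summable_sq hα_sq (r.summable_disagreement_sq hdom hs)
  refine ((hconsensus.mul_left (2 * L)).add ((hs l i).div_const 2)).congr fun t => ?_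
  rw [perturbation]
  ring

section Divergence

variable (r) (hdom : ∀ l, Convex ℝ (R l).dom) {z : ∀ k, E k} (hz : z ∈ Set.univ.pi Γ.X)
include hdom hz

lemma norm_sub_sq_le_bregman (t : ℕ) (ω : Ω) (l : Fin 2) (i : Fin (n l)) :
    1 / 2 * ‖z l - r.x l i t ω‖ ^ 2 ≤ bregman (Γ.X l) (R l).ψ (z l) (r.x l i t ω) :=
  mul_norm_sq_le_bregman (R l).strongConvexOn (hz l trivial)
    ((R l).dom_subset (r.mem_dom hdom t ω l i)) (r.differentiableWithinAt_ψ hdom t ω l i)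

lemma bregman_nonneg (t : ℕ) (ω : Ω) (l : Fin 2) (i : Fin (n l)) :
    0 ≤ bregman (Γ.X l) (R l).ψ (z l) (r.x l i t ω) :=
  le_trans (by positivity) (r.norm_sub_sq_le_bregman hdom hz t ω l i)

lemma divergence_nonneg (t : ℕ) (ω : Ω) : 0 ≤ r.divergence z t ω :=
  agentAverage_nonneg fun l i => r.bregman_nonneg hdom hz t ω l i

lemma norm_sub_sq_le_divergence (t : ℕ) (ω : Ω) (l : Fin 2) (i : Fin (n l)) :
    ‖r.x l i t ω - z l‖ ^ 2 ≤ 2 * n l * r.divergence z t ω := by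
  have hbregman := r.norm_sub_sq_le_bregman hdom hz t ω l i
  have haverage : bregman (Γ.X l) (R l).ψ (z l) (r.x l i t ω) ≤ n l * r.divergence z t ω :=
    le_mul_agentAverage (r.bregman_nonneg hdom hz t ω) l i
  rw [norm_sub_rev] at hbregman
  linarith

variable {r} in
lemma tendsto_of_tendsto_divergence {ω : Ω}
    (h : Tendsto (fun t => r.divergence z t ω) atTop (𝓝 0)) (l : Fin 2) (i : Fin (n l)) :
    Tendsto (fun t => r.x l i t ω) atTop (𝓝 (z l)) := by
  have hsq : Tendsto (fun t => ‖r.x l i t ω - z l‖ ^ 2) atTop (𝓝 0) :=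
    squeeze_zero (fun t => sq_nonneg _) (fun t => r.norm_sub_sq_le_divergence hdom hz t ω l i)
      (by simpa only [mul_zero] using h.const_mul (2 * (n l : ℝ)))
  rw [tendsto_iff_norm_sub_tendsto_zero]
  simpa only [Real.sqrt_sq (norm_nonneg _), Real.sqrt_zero] using hsq.sqrt

end Divergence

lemma tendsto_divergence_zero (hR : ∀ l, (R l).Reciprocal) {z : ∀ k, E k}
    (hz : z ∈ Set.univ.pi Γ.X) {φ : ℕ → ℕ}
    (h : ∀ l i, Tendsto (fun k => r.x l i (φ k) ω) atTop (𝓝 (z l))) :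
    Tendsto (fun k => r.divergence z (φ k) ω) atTop (𝓝 0) := by
  have hbregman : Tendsto (fun k l i => bregman (Γ.X l) (R l).ψ (z l) (r.x l i (φ k) ω)) atTop
      (𝓝 0) :=
    tendsto_pi_nhds.2 fun l => tendsto_pi_nhds.2 fun i => (hR l).reciprocity _ (hz l trivial) _
      (fun k => r.mem_dom (fun l => (hR l).convex_dom) (φ k) ω l i) (h l i)
  have h0 := ((agentAverage n).continuous.tendsto 0).comp hbregman
  rwa [map_zero] at h0

lemma exists_tendsto_subseq (hdom : ∀ l, Convex ℝ (R l).dom) (hα : ∀ t, 0 ≤ α t)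
    (hα_sum : ¬ Summable α) (hU : Γ.StrictConvexConcave) {z : ∀ k, E k} (hz : Γ.IsNash z)
    (hs : ∀ l i, Summable fun t => ‖α t • r.ghat l i t ω‖ ^ 2)
    (hgap : Summable fun t => α t * Γ.gap z (r.mean t ω)) :
    ∃ φ : ℕ → ℕ, Tendsto φ atTop atTop ∧
      ∀ l i, Tendsto (fun k => r.x l i (φ k) ω) atTop (𝓝 (z l)) := by
  have hmean : ∀ t, r.mean t ω ∈ Set.univ.pi Γ.X := fun t => r.mean_mem hdom t ω
  obtain ⟨φ, hφ, hφ0⟩ := exists_subseq_tendsto_zero hα (fun t => hz.gap_nonneg (hmean t))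
    hgap hα_sum
  obtain ⟨y, hy, χ, hχ, hlim⟩ := (isCompact_univ_pi Γ.compact).tendsto_subseq
    fun k => hmean (φ k)
  have hgap_y : Γ.gap z y = 0 :=
    tendsto_nhds_unique ((Game.continuousOn_gap hz.1 y hy).tendsto.comp
      (tendsto_nhdsWithin_iff.2 ⟨hlim, Eventually.of_forall fun k => hmean _⟩))
      (hφ0.comp hχ.tendsto_atTop)
  obtain rfl := hz.eq_of_gap_nonpos hU hy hgap_y.le
  have hsub := hφ.tendsto_atTop.comp hχ.tendsto_atTop
  refine ⟨φ ∘ χ, hsub, fun l i => ?_⟩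
  simpa using ((r.tendsto_sub_mean_zero hdom hs l i).comp hsub).add (tendsto_pi_nhds.1 hlim l)

section Pathwise

variable (hR : ∀ l, (R l).Reciprocal) (hα : ∀ t, 0 ≤ α t) (hα_sq : Summable fun t => α t ^ 2)
  {L : ℝ} (hLip : Γ.LipschitzCosts L) {g : ∀ l, Fin (n l) → ℕ → Ω → StrongDual ℝ (E l)}
  (hg : r.IsCostSubgradient L g) {z : ∀ k, E k} (hz : Γ.IsNash z)
  (hs : ∀ l i, Summable fun t => ‖α t • r.ghat l i t ω‖ ^ 2)
  (hn : ∀ l i, ∃ c, Tendsto (fun T => ∑ t ∈ Finset.range T, r.noise g z t ω l i) atTop (𝓝 c))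
include hR hα hα_sq hLip hg hz hs hn

lemma exists_tendsto_divergence_and_summable_gap :
    (∃ v, Tendsto (fun t => r.divergence z t ω) atTop (𝓝 v)) ∧
      Summable fun t => α t * Γ.gap z (r.mean t ω) := by
  have hdom := fun l => (hR l).convex_dom
  choose c hc using hn
  have hnoise : Tendsto (fun T => ∑ t ∈ Finset.range T, agentAverage n (r.noise g z t ω)) atTop
      (𝓝 (agentAverage n c)) := by
    have hpi : Tendsto (fun T => ∑ t ∈ Finset.range T, r.noise g z t ω) atTop (𝓝 c) :=
      tendsto_pi_nhds.2 fun l => tendsto_pi_nhds.2 fun i => by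
        simpa only [Finset.sum_apply] using hc l i
    simpa only [Function.comp_def, map_sum] using
      ((agentAverage n).continuous.tendsto c).comp hpi
  exact exists_tendsto_of_descent (r.divergence_nonneg hdom hz.1 · ω)
    (fun t => mul_nonneg (hα t) (hz.gap_nonneg (r.mean_mem hdom t ω)))
    ((agentAverage n).summable (Pi.summable.2 fun l => Pi.summable.2 fun i =>
      summable_perturbation hdom hα_sq hs L l i))
    ⟨_, hnoise⟩ (divergence_succ_le hR hg hLip hz.1 hα · ω)

lemma tendsto_isNash (hα_sum : ¬ Summable α) (hU : Γ.StrictConvexConcave) (l : Fin 2)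
    (i : Fin (n l)) : Tendsto (fun t => r.x l i t ω) atTop (𝓝 (z l)) := by
  have hdom := fun l => (hR l).convex_dom
  obtain ⟨⟨v, hv⟩, hgap⟩ :=
    exists_tendsto_divergence_and_summable_gap hR hα hα_sq hLip hg hz hs hn
  obtain ⟨φ, hφ, hφz⟩ := exists_tendsto_subseq hdom hα hα_sum hU hz hs hgap
  obtain rfl : v = 0 := tendsto_nhds_unique (hv.comp hφ) (tendsto_divergence_zero hR hz.1 hφz)
  exact tendsto_of_tendsto_divergence hdom hz.1 hv l i

end Pathwise

end Run

namespace Run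

variable {Ω : Type*} [mΩ : MeasurableSpace Ω] {P : Measure Ω}
  {E : Fin 2 → Type*} [∀ l, NormedAddCommGroup (E l)] [∀ l, NormedSpace ℝ (E l)]
  [∀ l, MeasurableSpace (E l)] {n : Fin 2 → ℕ} {d : ℕ} {Γ : Game E P n d} {N : Network n}
  {R : ∀ l, Regularizer (Γ.X l)} {α : ℕ → ℝ}

section Information

variable (r : Run Γ N R α)

lemma info_mono : Monotone r.info := by
  intro s t hst
  rw [r.info_eq, r.info_eq]
  exact sup_le_sup le_rfl (iSup_mono fun u => iSup_mono' fun hu => ⟨hu.trans_le hst, le_rfl⟩)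

lemma info_le (t : ℕ) : r.info t ≤ mΩ := by
  rw [r.info_eq]
  refine sup_le (iSup_le fun l => iSup_le fun i => (r.init_measurable l i).comap_le) ?_
  exact iSup_le fun s => iSup_le fun _ => iSup_le fun l => iSup_le fun i =>
    (r.sample_measurable l i s).comap_le

/-- The filtration of the information available to the agents. -/
def filtration : Filtration ℕ mΩ := ⟨r.info, r.info_mono, r.info_le⟩

lemma measurable_x_zero (l : Fin 2) (i : Fin (n l)) : Measurable[r.info 0] (r.x l i 0) := by
  refine (comap_measurable (r.x l i 0)).mono ?_ le_rfl
  rw [r.info_eq]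
  exact le_sup_of_le_left (le_iSup₂_of_le l i le_rfl)

lemma stronglyMeasurable_point_of {s t : ℕ} (h : ∀ l i, StronglyMeasurable[r.info s] (r.x l i t))
    (l : Fin 2) (i : Fin (n l)) (k : Fin 2) :
    StronglyMeasurable[r.info s] fun ω => r.point l i t ω k :=
  Finset.stronglyMeasurable_fun_sum Finset.univ fun j _ => (h k j).const_smul (N.W l k t i j)

variable [∀ l, BorelSpace (E l)] (hdom : ∀ l, Convex ℝ (R l).dom)
include hdom

lemma stronglyMeasurable_x (t : ℕ) (l : Fin 2) (i : Fin (n l)) :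
    StronglyMeasurable[r.info t] (r.x l i t) := by
  induction t generalizing l i with
  | zero =>
    exact stronglyMeasurable_of_forall_mem_isCompact (Γ.compact l) (r.measurable_x_zero l i)
      fun ω => (R l).dom_subset (r.init_mem l i ω)
  | succ t ih =>
    have hpoint := (r.stronglyMeasurable_point_of ih l i l).mono (r.info_mono t.le_succ)
    exact IsProx.stronglyMeasurable (Γ.compact l)
      ((R l).strongConvexOn.strictConvexOn zero_lt_one) (R l).continuousOn hpoint
      (fun ω => (R l).dom_subset (r.point_mem_dom hdom l i t ω l))
      (r.differentiableWithinAt_ψ_point hdom t · l i)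
      ((r.ghat_measurable l i t).const_smul (α t)).neg (r.step l i t)

lemma stronglyMeasurable_point (l : Fin 2) (i : Fin (n l)) (t : ℕ) (k : Fin 2) :
    StronglyMeasurable[r.info t] fun ω => r.point l i t ω k :=
  r.stronglyMeasurable_point_of (r.stronglyMeasurable_x hdom t) l i k

end Information

variable {r : Run Γ N R α} {ν : Fin 2 → ℝ} {g : ∀ l, Fin (n l) → ℕ → Ω → StrongDual ℝ (E l)}

lemma noise_sq_le (hdom : ∀ l, Convex ℝ (R l).dom) {z : ∀ k, E k} (hz : z ∈ Set.univ.pi Γ.X)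
    (l : Fin 2) (i : Fin (n l)) (t : ℕ) (ω : Ω) :
    r.noise g z t ω l i ^ 2 ≤
      α t ^ 2 * Metric.diam (Γ.X l) ^ 2 * ‖g l i t ω - r.ghat l i t ω‖ ^ 2 := by
  have hdist : ‖z l - r.point l i t ω l‖ ≤ Metric.diam (Γ.X l) := by
    rw [← dist_eq_norm]
    exact Metric.dist_le_diam_of_mem (Γ.compact l).isBounded (hz l trivial)
      (r.point_mem hdom l i t ω l trivial)
  have happly : |(r.ghat l i t ω - g l i t ω) (z l - r.point l i t ω l)| ≤
      ‖g l i t ω - r.ghat l i t ω‖ * Metric.diam (Γ.X l) := by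
    rw [norm_sub_rev]
    exact (r.ghat l i t ω - g l i t ω).le_of_opNorm_le_of_le le_rfl hdist
  have hsq := pow_le_pow_left₀ (abs_nonneg _) happly 2
  rw [sq_abs, mul_pow] at hsq
  rw [noise, mul_pow]
  calc α t ^ 2 * (r.ghat l i t ω - g l i t ω) (z l - r.point l i t ω l) ^ 2
      ≤ α t ^ 2 * (‖g l i t ω - r.ghat l i t ω‖ ^ 2 * Metric.diam (Γ.X l) ^ 2) :=
        mul_le_mul_of_nonneg_left hsq (sq_nonneg _)
    _ = _ := by ring

namespace UnbiasedBounded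

variable (h : r.UnbiasedBounded ν g)
include h

lemma integral_sq_le [IsProbabilityMeasure P] (l : Fin 2) (i : Fin (n l)) (t : ℕ) :
    ∫ ω, ‖g l i t ω - r.ghat l i t ω‖ ^ 2 ∂P ≤ ν l ^ 2 := by
  rw [← integral_condExp (r.info_le t)]
  calc _ ≤ ∫ _, ν l ^ 2 ∂P :=
        integral_mono_ae integrable_condExp (integrable_const _) (h.variance l i t)
    _ = ν l ^ 2 := by simp

lemma summable_integral_sq [IsProbabilityMeasure P] (hα_sq : Summable fun t => α t ^ 2)
    (l : Fin 2) (i : Fin (n l)) :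
    Summable fun t => ∫ ω, α t ^ 2 * ‖g l i t ω - r.ghat l i t ω‖ ^ 2 ∂P := by
  refine (hα_sq.mul_right (ν l ^ 2)).of_nonneg_of_le
    (fun t => integral_nonneg fun ω => by positivity) fun t => ?_
  rw [integral_const_mul]
  exact mul_le_mul_of_nonneg_left (h.integral_sq_le l i t) (sq_nonneg _)

lemma ae_summable_norm_sq [IsProbabilityMeasure P] {L : ℝ} (hg : r.IsCostSubgradient L g)
    (hα_sq : Summable fun t => α t ^ 2) (l : Fin 2) (i : Fin (n l)) :
    ∀ᵐ ω ∂P, Summable fun t => ‖α t • r.ghat l i t ω‖ ^ 2 := by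
  have herror : ∀ᵐ ω ∂P, Summable fun t => α t ^ 2 * ‖g l i t ω - r.ghat l i t ω‖ ^ 2 := by
    have hnorm : ∀ t ω, ‖α t ^ 2 * ‖g l i t ω - r.ghat l i t ω‖ ^ 2‖ =
        α t ^ 2 * ‖g l i t ω - r.ghat l i t ω‖ ^ 2 := fun t ω =>
      Real.norm_of_nonneg (by positivity)
    have hsum := ae_summable_norm_of_summable_integral_norm (P := P)
      (h := fun t ω => α t ^ 2 * ‖g l i t ω - r.ghat l i t ω‖ ^ 2)
      (fun t => (h.integrable_sq l i t).const_mul _)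
    simp only [hnorm] at hsum
    exact hsum (h.summable_integral_sq hα_sq l i)
  filter_upwards [herror] with ω hω
  refine ((hα_sq.mul_right (2 * L ^ 2)).add (hω.mul_left 2)).of_nonneg_of_le
    (fun t => sq_nonneg _) fun t => ?_
  have htri : ‖r.ghat l i t ω‖ ≤ L + ‖g l i t ω - r.ghat l i t ω‖ :=
    (norm_le_norm_add_norm_sub (g l i t ω) _).trans (add_le_add_left (hg l i t ω).2 _)
  calc ‖α t • r.ghat l i t ω‖ ^ 2 = α t ^ 2 * ‖r.ghat l i t ω‖ ^ 2 := by
        rw [norm_smul, mul_pow, Real.norm_eq_abs, sq_abs]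
    _ ≤ α t ^ 2 * (2 * (L ^ 2 + ‖g l i t ω - r.ghat l i t ω‖ ^ 2)) :=
        mul_le_mul_of_nonneg_left
          ((pow_le_pow_left₀ (norm_nonneg _) htri 2).trans add_sq_le) (sq_nonneg _)
    _ = _ := by ring

omit h in
lemma congr {g' : ∀ l, Fin (n l) → ℕ → Ω → StrongDual ℝ (E l)} (h : r.UnbiasedBounded ν g)
    (hgg' : ∀ l i t, g l i t =ᵐ[P] g' l i t) : r.UnbiasedBounded ν g' where
  integrable := h.integrable
  integrable_sq l i t := (h.integrable_sq l i t).congr <| by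
    filter_upwards [hgg' l i t] with ω hω
    rw [hω]
  unbiased l i t := (h.unbiased l i t).trans (hgg' l i t)
  variance l i t := by
    refine (condExp_congr_ae ?_).trans_le (h.variance l i t)
    filter_upwards [hgg' l i t] with ω hω
    rw [hω]

end UnbiasedBounded

section Noise

variable [∀ l, BorelSpace (E l)] (hdom : ∀ l, Convex ℝ (R l).dom)
  (hgm : ∀ l i t, StronglyMeasurable[r.info t] (g l i t))
include hdom hgm

lemma stronglyMeasurable_noise (z : ∀ k, E k) (l : Fin 2) (i : Fin (n l)) (t : ℕ) :
    StronglyMeasurable[r.info (t + 1)] fun ω => r.noise g z t ω l i := by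
  have hle := r.info_mono t.le_succ
  have happly : Continuous fun q : StrongDual ℝ (E l) × E l => α t * q.1 q.2 := by fun_prop
  exact happly.comp_stronglyMeasurable
    (((r.ghat_measurable l i t).sub ((hgm l i t).mono hle)).prodMk
      (stronglyMeasurable_const.sub ((r.stronglyMeasurable_point hdom l i t l).mono hle)))

variable (h : r.UnbiasedBounded ν g) {z : ∀ k, E k} (hz : z ∈ Set.univ.pi Γ.X)
include h hz

lemma memLp_noise (l : Fin 2) (i : Fin (n l)) (t : ℕ) :
    MemLp (fun ω => r.noise g z t ω l i) 2 P := by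
  have hm := ((stronglyMeasurable_noise hdom hgm z l i t).mono
    (r.info_le (t + 1))).aestronglyMeasurable (μ := P)
  refine (memLp_two_iff_integrable_sq hm).2 (((h.integrable_sq l i t).const_mul
    (α t ^ 2 * Metric.diam (Γ.X l) ^ 2)).mono' (hm.pow 2) (Eventually.of_forall fun ω => ?_))
  exact (Real.norm_of_nonneg (sq_nonneg _)).trans_le (noise_sq_le hdom hz l i t ω)

lemma condExp_noise_eq_zero [IsFiniteMeasure P] (l : Fin 2) (i : Fin (n l)) (t : ℕ) :
    P[fun ω => r.noise g z t ω l i | r.info t] =ᵐ[P] 0 := by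
  have hw : StronglyMeasurable[r.info t] fun ω => α t • (z l - r.point l i t ω l) :=
    (stronglyMeasurable_const.sub (r.stronglyMeasurable_point hdom l i t l)).const_smul (α t)
  have hnoise : (fun ω => r.noise g z t ω l i) =
      fun ω => (r.ghat l i t - g l i t) ω (α t • (z l - r.point l i t ω l)) := by
    funext ω
    rw [noise, Pi.sub_apply, map_smul, smul_eq_mul]
  have hgi : Integrable (g l i t) P := integrable_condExp.congr (h.unbiased l i t)
  have hzero : P[r.ghat l i t - g l i t | r.info t] =ᵐ[P] 0 := by
    have hsub := condExp_sub (h.integrable l i t) hgi (r.info t)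
    rw [condExp_of_stronglyMeasurable (r.info_le t) (hgm l i t) hgi] at hsub
    filter_upwards [hsub, h.unbiased l i t] with ω hω hunbiased
    rw [hω, Pi.sub_apply, hunbiased, sub_self, Pi.zero_apply]
  have hint := (memLp_noise hdom hgm h hz l i t).integrable one_le_two
  rw [hnoise] at hint ⊢
  exact condExp_apply_eq_zero_of_condExp_eq_zero hw hint ((h.integrable l i t).sub hgi) hzero

variable [IsProbabilityMeasure P] (hα_sq : Summable fun t => α t ^ 2)
include hα_sq

lemma summable_integral_noise_sq (l : Fin 2) (i : Fin (n l)) :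
    Summable fun t => ∫ ω, r.noise g z t ω l i ^ 2 ∂P := by
  refine ((h.summable_integral_sq hα_sq l i).mul_left (Metric.diam (Γ.X l) ^ 2)).of_nonneg_of_le
    (fun t => integral_nonneg fun ω => sq_nonneg _) fun t => ?_
  rw [← integral_const_mul]
  refine integral_mono (memLp_noise hdom hgm h hz l i t).integrable_sq
    (((h.integrable_sq l i t).const_mul _).const_mul _) fun ω => ?_
  exact (noise_sq_le hdom hz l i t ω).trans_eq (by ring)

lemma ae_tendsto_sum_noise_of_stronglyMeasurable (l : Fin 2) (i : Fin (n l)) :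
    ∀ᵐ ω ∂P, ∃ c,
      Tendsto (fun T => ∑ t ∈ Finset.range T, r.noise g z t ω l i) atTop (𝓝 c) :=
  ae_tendsto_sum_of_martingaleDifference (ℱ := r.filtration)
    (stronglyMeasurable_noise hdom hgm z l i) (memLp_noise hdom hgm h hz l i)
    (condExp_noise_eq_zero hdom hgm h hz l i) (summable_integral_noise_sq hdom hgm h hz hα_sq l i)

omit hgm in
lemma ae_tendsto_sum_noise (l : Fin 2) (i : Fin (n l)) :
    ∀ᵐ ω ∂P, ∃ c,
      Tendsto (fun T => ∑ t ∈ Finset.range T, r.noise g z t ω l i) atTop (𝓝 c) := by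
  have hcond := ae_tendsto_sum_noise_of_stronglyMeasurable hdom
    (fun _ _ _ => stronglyMeasurable_condExp)
    (h.congr fun l i t => (h.unbiased l i t).symm) hz hα_sq l i
  filter_upwards [hcond, ae_all_iff.2 (h.unbiased l i)] with ω hω hunbiased
  simpa only [noise, hunbiased] using hω

end Noise

end Run

end DSMD

open MeasureTheory ProbabilityTheory Filter Topology in
theorem theorem5_general {Ω : Type*} [MeasurableSpace Ω] (P : Measure Ω) [IsProbabilityMeasure P]
    {E : Fin 2 → Type*} [∀ l, NormedAddCommGroup (E l)] [∀ l, NormedSpace ℝ (E l)]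
    [∀ l, MeasurableSpace (E l)] [∀ l, BorelSpace (E l)]
    {n : Fin 2 → ℕ} {d : ℕ}
    (Γ : DSMD.Game E P n d) (N : DSMD.Network n) (R : ∀ l, DSMD.Regularizer (Γ.X l))
    (α : ℕ → ℝ) (hα_nonneg : ∀ t, 0 ≤ α t)
    (r : DSMD.Run Γ N R α)
    (hU : Γ.StrictConvexConcave)
    (L : ℝ) (hLip : Γ.LipschitzCosts L)
    (g : ∀ l, Fin (n l) → ℕ → Ω → StrongDual ℝ (E l)) (hg : r.IsCostSubgradient L g)
    (ν : Fin 2 → ℝ) (hA2 : r.UnbiasedBounded ν g)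
    (hA3 : ∀ l, (R l).Reciprocal)
    (hα_sum : Tendsto (fun T => ∑ t ∈ Finset.Icc 1 T, α t) atTop atTop)
    (hα_sq : Summable (fun t => α t ^ 2)) :
    ∃ xs : ∀ l, E l, Γ.IsNash xs ∧ (∀ y, Γ.IsNash y → y = xs) ∧
      ∀ᵐ ω ∂P, ∀ l i, Tendsto (fun t => r.x l i t ω) atTop (𝓝 (xs l)) := by
  obtain ⟨xs, hxs⟩ := Γ.exists_isNash
  have hdiv : ¬ Summable α := fun hs => by
    obtain ⟨T, hT⟩ := (hα_sum.eventually_gt_atTop (∑' t, α t)).exists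
    exact hT.not_ge (hs.sum_le_tsum _ fun t _ => hα_nonneg t)
  have hnoise : ∀ᵐ ω ∂P, ∀ l i, ∃ c,
      Tendsto (fun T => ∑ t ∈ Finset.range T, r.noise g xs t ω l i) atTop (𝓝 c) :=
    ae_all_iff.2 fun l => ae_all_iff.2
      (DSMD.Run.ae_tendsto_sum_noise (fun k => (hA3 k).convex_dom) hA2 hxs.1 hα_sq l)
  have hghat : ∀ᵐ ω ∂P, ∀ l i, Summable fun t => ‖α t • r.ghat l i t ω‖ ^ 2 :=
    ae_all_iff.2 fun l => ae_all_iff.2 (hA2.ae_summable_norm_sq hg hα_sq l)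
  refine ⟨xs, hxs, fun y hy => hxs.unique hU hy, ?_⟩
  filter_upwards [hghat, hnoise] with ω hs hn
  exact DSMD.Run.tendsto_isNash hA3 hα_nonneg hα_sq hLip hg hxs hs hn hdiv hU

open MeasureTheory ProbabilityTheory Filter Topology in
theorem theorem5 {Ω : Type*} [MeasurableSpace Ω] (P : Measure Ω) [IsProbabilityMeasure P]
    {E : Fin 2 → Type*} [∀ l, NormedAddCommGroup (E l)] [∀ l, NormedSpace ℝ (E l)]
    [∀ l, FiniteDimensional ℝ (E l)] [∀ l, MeasurableSpace (E l)] [∀ l, BorelSpace (E l)]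
    {n : Fin 2 → ℕ} {d : ℕ}
    (Γ : DSMD.Game E P n d) (N : DSMD.Network n) (R : ∀ l, DSMD.Regularizer (Γ.X l))
    (α : ℕ → ℝ) (hα_nonneg : ∀ t, 0 ≤ α t) (hα_anti : Antitone α)
    (r : DSMD.Run Γ N R α)
    (hU : Γ.StrictConvexConcave)
    (L : ℝ) (hL : 0 < L) (hLip : Γ.LipschitzCosts L)
    (g : ∀ l, Fin (n l) → ℕ → Ω → StrongDual ℝ (E l)) (hg : r.IsCostSubgradient L g)
    (ν : Fin 2 → ℝ) (hν : ∀ l, 0 < ν l) (hA2 : r.UnbiasedBounded ν g)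
    (hA3 : ∀ l, (R l).Reciprocal)
    (hα_sum : Tendsto (fun T => ∑ t ∈ Finset.Icc 1 T, α t) atTop atTop)
    (hα_sq : Summable (fun t => α t ^ 2)) :
    ∃ xs : ∀ l, E l, Γ.IsNash xs ∧ (∀ y, Γ.IsNash y → y = xs) ∧
      ∀ᵐ ω ∂P, ∀ l i, Tendsto (fun t => r.x l i t ω) atTop (𝓝 (xs l)) :=
  theorem5_general P Γ N R α hα_nonneg r hU L hLip g hg ν hA2 hA3 hα_sum hα_sq
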